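/- **Theorem 2.** Let $0<\rho<\infty$ and let $G$ be analytic in $|z|<\rho$ with $G(0)>0$, such that $[z^j]G(z)\ge 0$ for all $j\ge0$, $\gcd\{j : [z^j]G(z)>0\}=1$, and the equation $zG'(z)=G(z)$ has a unique solution in the interval $(0,\rho)$. Let $f$ be the power series satisfying $f=zG(f)$, and write $\phi=\log G$. Then there is exactly one $R\in(0,\rho)$ with $R\phi'(R)=1$; for this $R$ the number $R\phi'(R)+R^2\phi''(R)$ is real and positive, and we let $\sigma(R)>0$ be its square root. As $n\to\infty$, $$n[z^n]f(z)\sim\frac{R^{1-n}G(R)^n}{\sqrt{2\pi n}\,\sigma(R)}\sum_{m\ge0}h_{2m}\frac{(-1)^m(2m)!}{2^m m!}\,(\sigma(R)^2n)^{-m},$$ in the sense that for every $M\ge0$ the sum truncated to $m<M$ gives $n[z^n]f(z)$ up to an error $O(n^{-M})$ times the prefactor, where $$h_m=[v^m]\left(\frac{\frac12\sigma(R)^2v^2}{\phi(R(1+v))-\phi(R)-R\phi'(R)\log(1+v)}\right)^{\frac12(m+1)}.$$ The same expansion holds with $h_{2m}$ replaced by $g_{2m}$ (the version obtained from a circular contour),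 where $$g_m=[t^m]\,e^t\left(\frac{\frac12\sigma(R)^2t^2}{\phi(Re^t)-\phi(R)-R\phi'(R)t}\right)^{\frac12(m+1)},$$ and in fact $g_m=h_m$ for all $m\ge0$. (The bracketed quotients are extended by their limit $1$ at the origin, and the powers are the branches equal to $1$ there.) -/

import Mathlib

open scoped ComplexOrder Topology Nat
open Filter Asymptotics

/-- The Taylor coefficient `[z^m] F(z)` at the origin. -/
noncomputable def taylorCoeff (F : ℂ → ℂ) (m : ℕ) : ℂ :=
  iteratedDeriv m F 0 / (m ! : ℂ)

/-- The Taylor series of `F` at the origin, as a formal power series. -/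
noncomputable def taylorPS (F : ℂ → ℂ) : PowerSeries ℂ :=
  PowerSeries.mk (taylorCoeff F)

/-- A function with a removable singularity at the origin, extended to the origin by its limit
there. -/
noncomputable def fillZero (F : ℂ → ℂ) : ℂ → ℂ :=
  Function.update F 0 (limUnder (𝓝[≠] 0) F)

/-- The subcriticality conditions for `G` on the disc of radius `ρ`, including `G(0) > 0`.
For complex numbers, `0 ≤ a` and `0 < a` mean that `a` is a nonnegative, resp. positive, real. -/
structure Subcritical (G : ℂ → ℂ) (ρ : ℝ) : Prop where
  radius_pos : 0 < ρ
  analytic : AnalyticOnNhd ℂ G (Metric.ball 0 ρ)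
  zero_pos : 0 < G 0
  coeff_nonneg : ∀ j, 0 ≤ taylorCoeff G j
  aperiodic : Nat.setGcd {j : ℕ | 0 < taylorCoeff G j} = 1
  root : ∃! r : ℝ, 0 < r ∧ r < ρ ∧ (r : ℂ) * deriv G r = G r

/-- `φ = log G` (principal branch; it is only used near points where `G` is positive). -/
noncomputable def logG (G : ℂ → ℂ) : ℂ → ℂ := fun z => Complex.log (G z)

/-- `σ(R)² = R φ'(R) + R² φ''(R)`. -/
noncomputable def sigmaSq (phi : ℂ → ℂ) (R : ℂ) : ℂ :=
  R * deriv phi R + R ^ 2 * deriv (deriv phi) R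

/-- `h_m = [v^m] (½σ(R)²v² / (φ(R(1+v)) - φ(R) - Rφ'(R) log(1+v)))^((m+1)/2)`. -/
noncomputable def hCoeff (phi : ℂ → ℂ) (R : ℂ) (m : ℕ) : ℂ :=
  taylorCoeff (fillZero fun v =>
    ((1 / 2 * sigmaSq phi R * v ^ 2) /
      (phi (R * (1 + v)) - phi R - R * deriv phi R * Complex.log (1 + v))) ^ (((m : ℂ) + 1) / 2)) m

/-- `g_m = [t^m] e^t (½σ(R)²t² / (φ(Re^t) - φ(R) - Rφ'(R)t))^((m+1)/2)`. -/
noncomputable def gCoeff (phi : ℂ → ℂ) (R : ℂ) (m : ℕ) : ℂ :=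
  taylorCoeff (fillZero fun t =>
    Complex.exp t * ((1 / 2 * sigmaSq phi R * t ^ 2) /
      (phi (R * Complex.exp t) - phi R - R * deriv phi R * t)) ^ (((m : ℂ) + 1) / 2)) m

/-- The prefactor `R^(1-n) G(R)^n / (√(2πn) σ)`. -/
noncomputable def lagPrefactor (G : ℂ → ℂ) (R σ : ℝ) (n : ℕ) : ℂ :=
  (R : ℂ) ^ (1 - (n : ℤ)) * G R ^ n / ((√(2 * Real.pi * n) * σ : ℝ) : ℂ)

/-- The Poincaré asymptotic expansion
`a_n ∼ R^(1-n) G(R)^n / (√(2πn) σ) · ∑_{m ≥ 0} c_{2m} (-1)^m (2m)!/(2^m m!) (σ²n)^(-m)`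
as `n → ∞`: for every `M`, truncating the sum after `M` terms leaves an error that is
`O(n^(-M))` relative to the prefactor. -/
def HasLagExpansion (G : ℂ → ℂ) (R σ : ℝ) (c : ℕ → ℂ) (a : ℕ → ℂ) : Prop :=
  ∀ M : ℕ,
    (fun n : ℕ => a n - lagPrefactor G R σ n *
      ∑ m ∈ Finset.range M, c (2 * m) * ((-1) ^ m * ((2 * m)! : ℂ) / (2 ^ m * (m ! : ℂ))) *
        (((σ : ℂ) ^ 2 * (n : ℂ)) ^ m)⁻¹)
    =O[atTop] fun n : ℕ => lagPrefactor G R σ n * ((n : ℂ) ^ M)⁻¹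

/-!
Lagrange inversion turns `n [z^n] f` into `[w^(n-1)] G(w)^n`, and Cauchy's formula on the circle
`w = R e^t`, `t = iθ`, turns this into `R^(1-n) / 2π` times the integral over `θ ∈ [-π, π]` of
`e^t (G(R e^t) e^(-t))^n`. The equation `R φ'(R) = 1` makes `t = 0` a critical point of the exponent
`φ(R e^t) - φ(R) - t`, with second derivative `σ²`, where `σ² = R² G''(R) / G(R) > 0`. Since the
coefficients of `G` are nonnegative and aperiodic, `|G|` is strictly smaller elsewhere on the circle
(`Subcritical.norm_apply_lt`), so up to an exponentially small error only a short arc around `t = 0`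
matters.

Near `0` the exponent is `σ² u² / 2` for an analytic coordinate `u = t U(t)` with `U(0) = 1`
(`exists_quadratic_coordinate`). The contour is never moved. Instead, `e^t` is expanded as
`∑ c_k u^k u'` with a remainder of high order in `t`. The integrals of `u^k u' e^(n σ² u² / 2)` obey
the recursion of Gaussian moments up to exponentially small boundary terms
(`IsCoordinate.moment_succ_isBigO`), and the one with `k = 0` depends only on the end points of the
path (`IsCoordinate.moment_zero_isBigO`). This gives the factors `(-1)^m (2m)! / (2^m m!) (σ² n)^(-m)`.

A single formal fact, that `[X^m] u^k u' U^(-(m+1))` is `1` if `k = m` and `0` otherwise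
(`coeff_pow_mul_derivative_mul_inv_pow`), governs all the coefficients. It proves Lagrange inversion,
it identifies `c_m = [t^m] e^t U^(-(m+1))`, which is `g_m`, and it gives `g_m = h_m`: under
`v = e^t - 1` the form `e^t dt` becomes `dv`, so both are the `m`-th coefficient of one expansion in
powers of the same coordinate (`coeff_exp_coordinate_eq`).
-/

/-! ### Residues of formal power series and Lagrange inversion -/

section Formal
open PowerSeries

variable {K : Type*} [Field K] [CharZero K]

/-- With `u = X * U` and `H = 1 / U`, the coefficient is the residue of `u ^ (k - m - 1) du`. For
`k ≠ m` this is an exact differential, so the residue vanishes; for `k = m` it is `du / u`, of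
residue `1`. -/
theorem coeff_pow_mul_derivative_mul_inv_pow {U H : PowerSeries K} (hUH : U * H = 1) (k m : ℕ) :
    coeff m ((X * U) ^ k * derivative (R := K) (X * U) * H ^ (m + 1)) = if k = m then 1 else 0 := by
  have hD : derivative (R := K) U * H = - (U * derivative (R := K) H) := by
    have := congrArg (derivative (R := K)) hUH
    simp only [Derivation.leibniz, smul_eq_mul, ← map_one (C (R := K)), derivative_C] at this
    linear_combination this
  have hu : derivative (R := K) (X * U) = U + X * derivative (R := K) U := by
    simp only [Derivation.leibniz, smul_eq_mul, derivative_X]; ring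
  rcases lt_trichotomy k m with h | h | h
  · obtain ⟨N, rfl⟩ : ∃ N, m = k + (N + 1) := ⟨m - k - 1, by omega⟩
    have h1 : (X * U) ^ k * derivative (R := K) (X * U) * H ^ (k + (N + 1) + 1)
        = X ^ k * (H ^ (N + 1) - X * (H ^ N * derivative (R := K) H)) := by
      have e : U ^ k * H ^ k = 1 := by rw [← mul_pow, hUH, one_pow]
      rw [hu, mul_pow]
      linear_combination (X ^ k * H ^ (N + 2) * (U + X * derivative (R := K) U)) * e
        + X ^ k * H ^ (N + 1) * hUH + X ^ (k + 1) * H ^ (N + 1) * hD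
        - X ^ (k + 1) * H ^ N * derivative (R := K) H * hUH
    have h2 : ((N : K) + 1) * coeff (N + 1) (X * (H ^ N * derivative (R := K) H))
        = ((N : K) + 1) * coeff (N + 1) (H ^ (N + 1)) := by
      have := coeff_derivative (H ^ (N + 1)) N
      rw [derivative_pow] at this
      rw [coeff_succ_X_mul, mul_comm _ (coeff (N + 1) (H ^ (N + 1))), ← this]
      have e : ((N + 1 : ℕ) : PowerSeries K) * H ^ (N + 1 - 1) * derivative (R := K) H
          = C ((N : K) + 1) * (H ^ N * derivative (R := K) H) := by
        simp [mul_assoc]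
      rw [e, coeff_C_mul]
    have h3 := mul_left_cancel₀ (Nat.cast_add_one_ne_zero N) h2
    rw [h1, coeff_X_pow_mul', if_pos (by omega), if_neg (by omega), Nat.add_sub_cancel_left,
      map_sub, h3, sub_self]
  · subst h
    have h1 : (X * U) ^ k * derivative (R := K) (X * U) * H ^ (k + 1)
        = X ^ k * (1 + X * (derivative (R := K) U * H)) := by
      have e : U ^ k * H ^ k = 1 := by rw [← mul_pow, hUH, one_pow]
      rw [hu, mul_pow]
      linear_combination (X ^ k * H * (U + X * derivative (R := K) U)) * e + X ^ k * hUH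
    rw [h1, coeff_X_pow_mul', if_pos le_rfl, if_pos rfl]
    simp
  · rw [if_neg (by omega), mul_pow, mul_assoc, mul_assoc, coeff_X_pow_mul', if_neg (by omega)]

/-- Every power series `F` expands as `∑ c k * u ^ k * u'` in the coordinate `u = X * U`; by residues
the coefficients are `c k = [X ^ k] F / U ^ (k + 1)`. -/
theorem X_pow_dvd_sub_sum {U H : PowerSeries K} (hUH : U * H = 1) (F : PowerSeries K) (N : ℕ) :
    X ^ N ∣ F - ∑ k ∈ Finset.range N,
      C (coeff k (F * H ^ (k + 1))) * ((X * U) ^ k * derivative (R := K) (X * U)) := by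
  induction N with
  | zero => simp
  | succ N ih =>
    obtain ⟨r, hr⟩ := ih
    rw [Finset.sum_range_succ, ← sub_sub, hr]
    have hc : coeff N (F * H ^ (N + 1)) = coeff 0 (r * H ^ (N + 1)) := by
      have h1 : F * H ^ (N + 1) = (∑ k ∈ Finset.range N,
          C (coeff k (F * H ^ (k + 1))) *
            ((X * U) ^ k * derivative (R := K) (X * U) * H ^ (N + 1)))
            + X ^ N * (r * H ^ (N + 1)) := by
        rw [← mul_assoc, ← hr, sub_mul, Finset.sum_mul]
        simp only [mul_assoc]
        ring
      rw [h1, map_add, map_sum, coeff_X_pow_mul', if_pos le_rfl, Nat.sub_self, Finset.sum_eq_zero,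
        zero_add]
      intro k hk
      rw [coeff_C_mul, coeff_pow_mul_derivative_mul_inv_pow hUH,
        if_neg (by have := Finset.mem_range.1 hk; omega), mul_zero]
    have hu : derivative (R := K) (X * U) = U + X * derivative (R := K) U := by
      simp only [Derivation.leibniz, smul_eq_mul, derivative_X]; ring
    have e : X ^ N * r - C (coeff N (F * H ^ (N + 1))) *
        ((X * U) ^ N * derivative (R := K) (X * U)) = X ^ N * (r -
          C (coeff N (F * H ^ (N + 1))) * (U ^ N * (U + X * derivative (R := K) U))) := by
      rw [hu]; ring
    rw [e, pow_succ]
    refine mul_dvd_mul_left _ (X_dvd_iff.2 ?_)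
    have hUH0 : constantCoeff U * constantCoeff H = 1 := by
      rw [← map_mul, hUH, map_one]
    rw [hc]
    simp only [coeff_zero_eq_constantCoeff, map_sub, map_mul, map_pow, map_add, constantCoeff_C,
      constantCoeff_X, zero_mul, add_zero]
    have : (constantCoeff H) ^ (N + 1) * constantCoeff U ^ (N + 1) = 1 := by
      rw [← mul_pow, mul_comm, hUH0, one_pow]
    linear_combination (-constantCoeff r) * this

/-- Uniqueness of the coefficients of an expansion in `u ^ k * u'`, where `u = X * U`. -/
theorem coeff_mul_inv_pow_of_X_pow_dvd {U H : PowerSeries K} (hUH : U * H = 1)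
    {F : PowerSeries K} {N : ℕ} {c : ℕ → K}
    (h : X ^ N ∣ F - ∑ k ∈ Finset.range N, C (c k) * ((X * U) ^ k * derivative (R := K) (X * U)))
    {m : ℕ} (hm : m < N) : coeff m (F * H ^ (m + 1)) = c m := by
  obtain ⟨r, hr⟩ := h
  have h1 : F * H ^ (m + 1) = (∑ k ∈ Finset.range N, C (c k) *
        ((X * U) ^ k * derivative (R := K) (X * U) * H ^ (m + 1))) + X ^ N * (r * H ^ (m + 1)) := by
    rw [← mul_assoc, ← hr, sub_mul, Finset.sum_mul]
    simp only [mul_assoc]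
    ring
  rw [h1, map_add, map_sum, coeff_X_pow_mul', if_neg (by omega), add_zero]
  simp only [coeff_C_mul, coeff_pow_mul_derivative_mul_inv_pow hUH, mul_ite, mul_one, mul_zero]
  simp [hm]

/-- Lagrange inversion. Expand `1 = ∑ c k * u ^ k * u'` in the coordinate `u = X / H`, whose
compositional inverse is `f`; substituting `f` and multiplying by `f'` gives `f' = ∑ c k * X ^ k`. -/
theorem lagrange_inversion {H f : PowerSeries K} (hH : constantCoeff H ≠ 0)
    (hf : f = X * H.subst f) (n : ℕ) :
    ((n : K) + 1) * coeff (n + 1) f = coeff n (H ^ (n + 1)) := by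
  have hs : HasSubst f := HasSubst.of_constantCoeff_zero' (by rw [hf]; simp)
  have hUH : H⁻¹ * H = 1 := PowerSeries.inv_mul_cancel H hH
  have hSU : (H⁻¹).subst f * H.subst f = 1 := by
    rw [← subst_mul hs, hUH, ← coe_substAlgHom hs, map_one]
  have hinv : (X * H⁻¹).subst f = (X : PowerSeries K) := by
    rw [subst_mul hs, subst_X hs]
    nth_rewrite 1 [hf]
    linear_combination X * hSU
  have hder : (derivative (R := K) (X * H⁻¹)).subst f * derivative (R := K) f = 1 := by
    rw [← derivative_subst hs, hinv, derivative_X]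
  obtain ⟨r, hr⟩ := X_pow_dvd_sub_sum hUH 1 (n + 1)
  generalize X * H⁻¹ = u at hr hinv hder
  have h1 := congrArg (substAlgHom hs) hr
  simp only [map_sub, map_one, map_sum, map_mul (substAlgHom hs), map_pow] at h1
  simp only [coe_substAlgHom, hinv, one_mul] at h1
  have h2 : derivative (R := K) f - ∑ k ∈ Finset.range (n + 1),
      C (coeff k (H ^ (k + 1))) * X ^ k =
        X ^ (n + 1) * ((H.subst f) ^ (n + 1) * r.subst f * derivative (R := K) f) := by
    have hXf : (X : PowerSeries K).subst f ^ (n + 1) = X ^ (n + 1) * (H.subst f) ^ (n + 1) := by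
      rw [subst_X hs, ← mul_pow, ← hf]
    have h3 : ∑ k ∈ Finset.range (n + 1), C (coeff k (H ^ (k + 1))) * X ^ k =
        (∑ k ∈ Finset.range (n + 1), (C (coeff k (H ^ (k + 1)))).subst f *
          (X ^ k * (derivative (R := K) u).subst f)) * derivative (R := K) f := by
      rw [Finset.sum_mul]
      refine Finset.sum_congr rfl fun k _ => ?_
      have hC (a : K) : (C a).subst f = (C a : PowerSeries K) := subst_C a
      rw [hC]
      linear_combination (-C (coeff k (H ^ (k + 1))) * X ^ k) * hder
    rw [h3]
    rw [hXf] at h1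
    linear_combination derivative (R := K) f * h1
  have h3 := congrArg (coeff n) h2
  rw [map_sub, coeff_X_pow_mul', if_neg (by omega), map_sum, sub_eq_zero, coeff_derivative] at h3
  rw [mul_comm, h3]
  simp [coeff_C_mul, coeff_X_pow]
end Formal

/-! ### Taylor series of analytic germs -/

section Taylor

theorem taylorPS_mul {F E : ℂ → ℂ} (hF : AnalyticAt ℂ F 0) (hE : AnalyticAt ℂ E 0) :
    taylorPS (fun z => F z * E z) = taylorPS F * taylorPS E := by
  ext n
  have := iteratedDeriv_mul (n := n) (hF.contDiffAt) (hE.contDiffAt)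
  rw [PowerSeries.coeff_mul, Finset.Nat.sum_antidiagonal_eq_sum_range_succ_mk]
  simp only [taylorPS, PowerSeries.coeff_mk, taylorCoeff]
  change iteratedDeriv n (F * E) 0 / _ = _
  rw [this, Finset.sum_div]
  refine Finset.sum_congr rfl fun i hi => ?_
  have hi' : i ≤ n := by simpa [Nat.lt_succ_iff] using hi
  rw [Nat.cast_choose ℂ hi']
  have h1 : (n ! : ℂ) ≠ 0 := by exact_mod_cast n.factorial_ne_zero
  field_simp

theorem taylorPS_congr {F E : ℂ → ℂ} (h : F =ᶠ[𝓝 0] E) : taylorPS F = taylorPS E := by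
  ext n
  simp only [taylorPS, PowerSeries.coeff_mk, taylorCoeff, h.iteratedDeriv_eq n]

theorem taylorPS_const (c : ℂ) : taylorPS (fun _ => c) = PowerSeries.C c := by
  ext n
  simp only [taylorPS, PowerSeries.coeff_mk, taylorCoeff, iteratedDeriv_const, PowerSeries.coeff_C]
  split_ifs with h <;> simp [h]

theorem taylorPS_deriv (F : ℂ → ℂ) :
    taylorPS (deriv F) = PowerSeries.derivative (R := ℂ) (taylorPS F) := by
  ext n
  rw [PowerSeries.coeff_derivative]
  simp only [taylorPS, PowerSeries.coeff_mk, taylorCoeff, ← iteratedDeriv_succ',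
    Nat.factorial_succ]
  have h1 : (n ! : ℂ) ≠ 0 := by exact_mod_cast n.factorial_ne_zero
  have h2 : (n : ℂ) + 1 ≠ 0 := Nat.cast_add_one_ne_zero n
  push_cast
  field_simp

theorem constantCoeff_taylorPS (F : ℂ → ℂ) : PowerSeries.constantCoeff (taylorPS F) = F 0 := by
  rw [← PowerSeries.coeff_zero_eq_constantCoeff_apply]
  simp [taylorPS, taylorCoeff]

theorem taylorPS_id : taylorPS (fun z => z) = PowerSeries.X := by
  refine PowerSeries.derivative.ext ?_ ?_
  · rw [← taylorPS_deriv, PowerSeries.derivative_X]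
    have : deriv (fun z : ℂ => z) = fun _ => 1 := by ext; simp
    rw [this, taylorPS_const, map_one]
  · rw [constantCoeff_taylorPS, PowerSeries.constantCoeff_X]

theorem taylorPS_pow {F : ℂ → ℂ} (hF : AnalyticAt ℂ F 0) (n : ℕ) :
    taylorPS (fun z => F z ^ n) = taylorPS F ^ n := by
  induction n with
  | zero => simpa using taylorPS_const 1
  | succ n ih => simp only [pow_succ, taylorPS_mul (hF.fun_pow n) hF, ih]

theorem taylorPS_sub {F E : ℂ → ℂ} (hF : AnalyticAt ℂ F 0) (hE : AnalyticAt ℂ E 0) :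
    taylorPS (fun z => F z - E z) = taylorPS F - taylorPS E := by
  ext n
  simp only [taylorPS, PowerSeries.coeff_mk, taylorCoeff, map_sub]
  rw [iteratedDeriv_fun_sub hF.contDiffAt hE.contDiffAt, sub_div]

theorem taylorPS_sum {ι : Type*} (s : Finset ι) {F : ι → ℂ → ℂ}
    (hF : ∀ i ∈ s, AnalyticAt ℂ (F i) 0) :
    taylorPS (fun z => ∑ i ∈ s, F i z) = ∑ i ∈ s, taylorPS (F i) := by
  ext n
  simp only [taylorPS, PowerSeries.coeff_mk, taylorCoeff, map_sum]
  rw [iteratedDeriv_fun_sum fun i hi => (hF i hi).contDiffAt, Finset.sum_div]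

theorem X_pow_dvd_taylorPS_iff {F : ℂ → ℂ} (hF : AnalyticAt ℂ F 0) (N : ℕ) :
    PowerSeries.X ^ N ∣ taylorPS F ↔
      ∃ r : ℂ → ℂ, AnalyticAt ℂ r 0 ∧ ∀ᶠ z in 𝓝 0, F z = z ^ N * r z := by
  have h1 := natCast_le_analyticOrderAt_iff_iteratedDeriv_eq_zero (n := N) hF
  rw [natCast_le_analyticOrderAt hF] at h1
  simp only [sub_zero, smul_eq_mul] at h1
  rw [h1, PowerSeries.X_pow_dvd_iff]
  simp only [taylorPS, PowerSeries.coeff_mk, taylorCoeff, div_eq_zero_iff, Nat.cast_eq_zero,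
    Nat.factorial_ne_zero, or_false]

end Taylor

/-! ### The quadratic local coordinate and the coefficients `g` and `h` -/

section LocalCoordinate

/-- A function that agrees with an analytic one on a punctured neighbourhood of the origin has, once
its singularity is removed by `fillZero`, the same Taylor coefficients. -/
theorem taylorCoeff_fillZero_of_eventuallyEq {F A : ℂ → ℂ} (hA : AnalyticAt ℂ A 0)
    (h : F =ᶠ[𝓝[≠] 0] A) (m : ℕ) : taylorCoeff (fillZero F) m = taylorCoeff A m := by
  have hlim : limUnder (𝓝[≠] (0 : ℂ)) F = A 0 :=
    ((hA.continuousAt.tendsto.mono_left nhdsWithin_le_nhds).congr' h.symm).limUnder_eq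
  have : fillZero F =ᶠ[𝓝 0] A := by
    have h' : ∀ᶠ z in 𝓝 (0 : ℂ), z ≠ 0 → F z = A z := by
      simpa [EventuallyEq, eventually_nhdsWithin_iff] using h
    filter_upwards [h'] with z hz
    by_cases hz0 : z = 0
    · subst hz0; simp [fillZero, hlim]
    · simp [fillZero, hz0, hz hz0]
  rw [taylorCoeff, taylorCoeff, this.iteratedDeriv_eq m]

/-- The principal power undoes the square in the right half plane, so that the half-integer powers in
`gCoeff` and `hCoeff` become ordinary powers. -/
theorem sq_cpow_half_succ {x : ℂ} (hx : 0 < x.re) (m : ℕ) :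
    (x ^ 2) ^ (((m : ℂ) + 1) / 2) = x ^ (m + 1) := by
  have hx0 : x ≠ 0 := by rintro rfl; simp at hx
  have harg : |x.arg| < Real.pi / 2 := Complex.abs_arg_lt_pi_div_two_iff.2 (Or.inl hx)
  have hlog : Complex.log (x ^ 2) = 2 * Complex.log x := by
    rw [abs_lt] at harg
    have him : (2 * Complex.log x).im = 2 * x.arg := by simp [Complex.log_im]
    rw [← Complex.log_exp (x := 2 * Complex.log x) (by rw [him]; linarith)
      (by rw [him]; linarith), two_mul, Complex.exp_add, Complex.exp_log hx0, sq]
  rw [Complex.cpow_def_of_ne_zero (pow_ne_zero 2 hx0), hlog,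
    show 2 * Complex.log x * (((m : ℂ) + 1) / 2) = ((m + 1 : ℕ) : ℂ) * Complex.log x by
      push_cast; ring, Complex.exp_nat_mul, Complex.exp_log hx0]

theorem taylorPS_mul_taylorPS_inv {U : ℂ → ℂ} (hU : AnalyticAt ℂ U 0) (hU0 : U 0 = 1) :
    taylorPS U * taylorPS (fun z => (U z)⁻¹) = 1 := by
  have hne : U 0 ≠ 0 := by simp [hU0]
  rw [← taylorPS_mul hU (hU.fun_inv hne), ← map_one (PowerSeries.C (R := ℂ)), ← taylorPS_const]
  refine taylorPS_congr ?_
  filter_upwards [hU.continuousAt.eventually_ne hne] with z hz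
  exact mul_inv_cancel₀ hz

/-- The shape shared by `gCoeff` and `hCoeff`: if `Q = 1 / U ^ 2` off the origin and `U 0 = 1`, then
the branch of `Q ^ ((m + 1) / 2)` in question is `1 / U ^ (m + 1)`. -/
theorem taylorCoeff_fillZero_cpow {E U Q : ℂ → ℂ} (hE : AnalyticAt ℂ E 0) (hU : AnalyticAt ℂ U 0)
    (hU0 : U 0 = 1) (hQ : ∀ᶠ z in 𝓝[≠] 0, Q z * U z ^ 2 = 1) (m : ℕ) :
    taylorCoeff (fillZero fun z => E z * Q z ^ (((m : ℂ) + 1) / 2)) m =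
      PowerSeries.coeff m (taylorPS E * taylorPS (fun z => (U z)⁻¹) ^ (m + 1)) := by
  have hne : U 0 ≠ 0 := by simp [hU0]
  have hinv := hU.fun_inv hne
  rw [← taylorPS_pow hinv, ← taylorPS_mul hE (hinv.fun_pow _)]
  rw [taylorPS, PowerSeries.coeff_mk]
  refine taylorCoeff_fillZero_of_eventuallyEq (hE.fun_mul (hinv.fun_pow _)) ?_ m
  have hre : ∀ᶠ z in 𝓝[≠] (0 : ℂ), 0 < ((U z)⁻¹).re := by
    refine nhdsWithin_le_nhds ?_
    have : ContinuousAt (fun z => ((U z)⁻¹).re) 0 :=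
      Complex.continuous_re.continuousAt.comp hinv.continuousAt
    exact this.eventually (lt_mem_nhds (by simp [hU0]))
  filter_upwards [hQ, hre] with z hz hz'
  have : Q z = (U z)⁻¹ ^ 2 := by rw [inv_pow]; exact eq_inv_of_mul_eq_one_left hz
  rw [this, sq_cpow_half_succ hz']

theorem taylorPS_sub_sum_coordinate {F U : ℂ → ℂ} (hF : AnalyticAt ℂ F 0) (hU : AnalyticAt ℂ U 0)
    (c : ℕ → ℂ) (N : ℕ) :
    AnalyticAt ℂ (fun z => F z - ∑ k ∈ Finset.range N,
      c k * ((z * U z) ^ k * deriv (fun z => z * U z) z)) 0 ∧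
    taylorPS (fun z => F z - ∑ k ∈ Finset.range N,
      c k * ((z * U z) ^ k * deriv (fun z => z * U z) z)) =
    taylorPS F - ∑ k ∈ Finset.range N, PowerSeries.C (c k) *
      ((PowerSeries.X * taylorPS U) ^ k *
        PowerSeries.derivative (R := ℂ) (PowerSeries.X * taylorPS U)) := by
  have hu : AnalyticAt ℂ (fun z => z * U z) 0 := analyticAt_id.fun_mul hU
  have hterm (k : ℕ) : AnalyticAt ℂ (fun z => (z * U z) ^ k * deriv (fun z => z * U z) z) 0 :=
    (hu.fun_pow k).fun_mul hu.deriv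
  have hterm' (k : ℕ) (_ : k ∈ Finset.range N) :
      AnalyticAt ℂ (fun z => c k * ((z * U z) ^ k * deriv (fun z => z * U z) z)) 0 :=
    analyticAt_const.fun_mul (hterm k)
  have hsum := Finset.analyticAt_fun_sum _ hterm'
  refine ⟨hF.fun_sub hsum, ?_⟩
  rw [taylorPS_sub hF hsum, taylorPS_sum _ hterm']
  congr 1
  refine Finset.sum_congr rfl fun k _ => ?_
  rw [taylorPS_mul analyticAt_const (hterm k), taylorPS_const,
    taylorPS_mul (hu.fun_pow k) hu.deriv, taylorPS_pow hu, taylorPS_deriv,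
    taylorPS_mul (F := fun z => z) analyticAt_id hU, taylorPS_id]

/-- Analytic form of `X_pow_dvd_sub_sum`, with an analytic remainder. -/
theorem exists_expansion_in_coordinate {F U : ℂ → ℂ} (hF : AnalyticAt ℂ F 0)
    (hU : AnalyticAt ℂ U 0) (hU0 : U 0 = 1) (N : ℕ) :
    ∃ r : ℂ → ℂ, AnalyticAt ℂ r 0 ∧ ∀ᶠ z in 𝓝 0, F z - ∑ k ∈ Finset.range N,
      PowerSeries.coeff k (taylorPS F * taylorPS (fun z => (U z)⁻¹) ^ (k + 1)) *
        ((z * U z) ^ k * deriv (fun z => z * U z) z) = z ^ N * r z := by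
  obtain ⟨h1, h2⟩ := taylorPS_sub_sum_coordinate hF hU
    (fun k => PowerSeries.coeff k (taylorPS F * taylorPS (fun z => (U z)⁻¹) ^ (k + 1))) N
  rw [← X_pow_dvd_taylorPS_iff h1, h2]
  exact X_pow_dvd_sub_sum (taylorPS_mul_taylorPS_inv hU hU0) _ N

/-- If the coordinates `u(t) = t * U t` and `v * V v` correspond under `v = exp t - 1`, then expanding
`1` in the second one, substituting and multiplying by `exp t = dv/dt` expands `exp` in the first,
with the same coefficients. -/
theorem coeff_exp_coordinate_eq {U V : ℂ → ℂ} (hU : AnalyticAt ℂ U 0) (hU0 : U 0 = 1)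
    (hV : AnalyticAt ℂ V 0) (hV0 : V 0 = 1)
    (hUV : ∀ᶠ t in 𝓝 0, t * U t = (Complex.exp t - 1) * V (Complex.exp t - 1)) (m : ℕ) :
    PowerSeries.coeff m (taylorPS Complex.exp * taylorPS (fun z => (U z)⁻¹) ^ (m + 1)) =
    PowerSeries.coeff m (taylorPS (fun _ => 1) * taylorPS (fun z => (V z)⁻¹) ^ (m + 1)) := by
  set d : ℕ → ℂ := fun k =>
    PowerSeries.coeff k (taylorPS (fun _ => 1) * taylorPS (fun z => (V z)⁻¹) ^ (k + 1))
  obtain ⟨r, hr, hre⟩ := exists_expansion_in_coordinate (F := fun _ => 1) analyticAt_const hV hV0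
    (m + 1)
  refine coeff_mul_inv_pow_of_X_pow_dvd (taylorPS_mul_taylorPS_inv hU hU0) (c := d) (N := m + 1)
    ?_ (Nat.lt_succ_self m)
  have hexp : AnalyticAt ℂ Complex.exp 0 := by fun_prop
  obtain ⟨h1, h2⟩ := taylorPS_sub_sum_coordinate hexp hU d (m + 1)
  rw [← h2, X_pow_dvd_taylorPS_iff h1]
  have he1 : AnalyticAt ℂ (fun t => Complex.exp t - 1) 0 := hexp.fun_sub analyticAt_const
  obtain ⟨q, hq, hqe⟩ : ∃ q : ℂ → ℂ, AnalyticAt ℂ q 0 ∧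
      ∀ᶠ t in 𝓝 0, Complex.exp t - 1 = t ^ 1 * q t := by
    rw [← X_pow_dvd_taylorPS_iff he1, pow_one, PowerSeries.X_dvd_iff, constantCoeff_taylorPS]
    simp
  have htend : Tendsto (fun t => Complex.exp t - 1) (𝓝 0) (𝓝 0) := by
    have := he1.continuousAt.tendsto
    simpa using this
  have hr' : AnalyticAt ℂ (fun t => r (Complex.exp t - 1)) 0 :=
    AnalyticAt.fun_comp (g := r) (f := fun t => Complex.exp t - 1) (by simpa using hr) he1
  refine ⟨fun t => Complex.exp t * (q t ^ (m + 1) * r (Complex.exp t - 1)),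
    hexp.fun_mul ((hq.fun_pow _).fun_mul hr'), ?_⟩
  have hderiv : ∀ᶠ t in 𝓝 (0 : ℂ), deriv (fun z => z * U z) t =
      deriv (fun z => z * V z) (Complex.exp t - 1) * Complex.exp t := by
    have hVan : ∀ᶠ v in 𝓝 (0 : ℂ), AnalyticAt ℂ (fun z => z * V z) v :=
      (analyticAt_id.fun_mul hV).eventually_analyticAt
    filter_upwards [hUV.eventually_nhds, htend.eventually hVan] with t ht ht'
    have : (fun z => z * U z) =ᶠ[𝓝 t] fun z => (Complex.exp z - 1) * V (Complex.exp z - 1) := ht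
    rw [this.deriv_eq]
    have hc := HasDerivAt.comp t ht'.differentiableAt.hasDerivAt
      ((Complex.hasDerivAt_exp t).sub_const 1)
    exact hc.deriv
  filter_upwards [hUV, hqe, hderiv, htend.eventually hre] with t h3 h4 h5 h6
  rw [h4] at h6 h3 h5 ⊢
  rw [h3, h5, pow_one] at *
  have : ∑ k ∈ Finset.range (m + 1), d k * ((t * q t * V (t * q t)) ^ k *
      (deriv (fun z => z * V z) (t * q t) * Complex.exp t)) =
      Complex.exp t * ∑ k ∈ Finset.range (m + 1), d k * ((t * q t * V (t * q t)) ^ k *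
        deriv (fun z => z * V z) (t * q t)) := by
    rw [Finset.mul_sum]
    exact Finset.sum_congr rfl fun k _ => by ring
  rw [this]
  linear_combination Complex.exp t * h6

/-- The Morse lemma in one complex variable: near a nondegenerate critical point at the origin with
value `0`, `D` is `s / 2` times the square of a coordinate tangent to the identity. -/
theorem exists_quadratic_coordinate {D : ℂ → ℂ} (hD : AnalyticAt ℂ D 0) (h0 : D 0 = 0)
    (h1 : deriv D 0 = 0) {s : ℂ} (h2 : deriv (deriv D) 0 = s) (hs : s ≠ 0) :
    ∃ U : ℂ → ℂ, AnalyticAt ℂ U 0 ∧ U 0 = 1 ∧ ∀ᶠ z in 𝓝 0, D z = s / 2 * (z * U z) ^ 2 := by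
  have hdvd : PowerSeries.X ^ 2 ∣ taylorPS D := by
    rw [PowerSeries.X_pow_dvd_iff]
    intro m hm
    interval_cases m <;> simp [taylorPS, taylorCoeff, h0, h1]
  obtain ⟨r, hr, hre⟩ := (X_pow_dvd_taylorPS_iff hD 2).1 hdvd
  have hr0 : r 0 = s / 2 := by
    have e : taylorPS D = PowerSeries.X ^ 2 * taylorPS r := by
      rw [taylorPS_congr hre, taylorPS_mul (F := fun z => z ^ 2) (analyticAt_id.fun_pow 2) hr,
        taylorPS_pow (F := fun z => z) analyticAt_id, taylorPS_id]
    have := congrArg (PowerSeries.coeff 2) e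
    rw [PowerSeries.coeff_X_pow_mul', if_pos le_rfl, Nat.sub_self,
      PowerSeries.coeff_zero_eq_constantCoeff_apply, constantCoeff_taylorPS] at this
    rw [← this, taylorPS, PowerSeries.coeff_mk, taylorCoeff, iteratedDeriv_succ',
      iteratedDeriv_one, h2]
    simp
  have hs2 : s / 2 ≠ 0 := div_ne_zero hs two_ne_zero
  have hS : AnalyticAt ℂ (fun z => r z / (s / 2)) 0 := hr.fun_div analyticAt_const hs2
  have hS0 : r 0 / (s / 2) = 1 := by rw [hr0, div_self hs2]
  refine ⟨fun z => Complex.exp (Complex.log (r z / (s / 2)) / 2), ?_, by simp [hS0], ?_⟩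
  · exact (AnalyticAt.clog hS (by simp [hS0])).fun_div analyticAt_const two_ne_zero |>.cexp
  · filter_upwards [hre, hS.continuousAt.eventually_ne (by rw [hS0]; exact one_ne_zero)] with z h3 h4
    rw [h3, mul_pow, ← Complex.exp_nat_mul]
    push_cast
    rw [mul_div_cancel₀ _ (two_ne_zero), Complex.exp_log h4]
    field_simp

/-- Transport of the coordinate `t * U t` to the variable `v = exp t - 1`. -/
theorem exists_log_coordinate {U : ℂ → ℂ} (hU : AnalyticAt ℂ U 0) (hU0 : U 0 = 1) :
    ∃ V : ℂ → ℂ, AnalyticAt ℂ V 0 ∧ V 0 = 1 ∧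
      (∀ᶠ v in 𝓝 0, v * V v = Complex.log (1 + v) * U (Complex.log (1 + v))) ∧
      ∀ᶠ t in 𝓝 0, t * U t = (Complex.exp t - 1) * V (Complex.exp t - 1) := by
  have hlog : AnalyticAt ℂ (fun v => Complex.log (1 + v)) 0 :=
    AnalyticAt.clog (analyticAt_const.fun_add analyticAt_id) (by simp)
  have hUl : AnalyticAt ℂ (fun v => U (Complex.log (1 + v))) 0 :=
    AnalyticAt.fun_comp (g := U) (f := fun v => Complex.log (1 + v)) (by simpa using hU) hlog
  have hW := hlog.fun_mul hUl
  obtain ⟨V, hV, hVe⟩ : ∃ q : ℂ → ℂ, AnalyticAt ℂ q 0 ∧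
      ∀ᶠ v in 𝓝 0, Complex.log (1 + v) * U (Complex.log (1 + v)) = v ^ 1 * q v := by
    rw [← X_pow_dvd_taylorPS_iff hW, pow_one, PowerSeries.X_dvd_iff, constantCoeff_taylorPS]
    simp
  simp only [pow_one] at hVe
  refine ⟨V, hV, ?_, ?_, ?_⟩
  · have h1 : HasDerivAt (fun v : ℂ => v * V v) (1 * V 0 + 0 * deriv V 0) 0 :=
      (hasDerivAt_id (0 : ℂ)).mul hV.differentiableAt.hasDerivAt
    have hl : HasDerivAt (fun v : ℂ => Complex.log (1 + v)) 1 0 := by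
      simpa using ((hasDerivAt_id (0 : ℂ)).const_add 1).clog (by simp)
    have h2 := hl.mul hUl.differentiableAt.hasDerivAt
    have h3 := h1.unique (h2.congr_of_eventuallyEq (hVe.mono fun v hv => hv.symm))
    simpa [hU0] using h3
  · filter_upwards [hVe] with v hv using hv.symm
  · have htend : Tendsto (fun t => Complex.exp t - 1) (𝓝 0) (𝓝 0) := by
      have : ContinuousAt (fun t => Complex.exp t - 1) 0 := by fun_prop
      simpa using this.tendsto
    have him : ∀ᶠ t : ℂ in 𝓝 0, |t.im| < 1 := by
      have : ContinuousAt (fun t : ℂ => |t.im|) 0 := by fun_prop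
      exact this.eventually (gt_mem_nhds (by simp))
    filter_upwards [htend.eventually hVe, him] with t h1 h2
    rw [← h1]
    have : Complex.log (1 + (Complex.exp t - 1)) = t := by
      rw [add_sub_cancel]
      rw [abs_lt] at h2
      exact Complex.log_exp (by linarith [Real.pi_gt_three]) (by linarith [Real.pi_gt_three])
    rw [this]

end LocalCoordinate

/-! ### Gaussian moments along a short segment of the imaginary axis -/

section Laplace

open Complex MeasureTheory

variable {U : ℂ → ℂ} {δ s : ℝ}

/-- On the closed disc of radius `δ`, `U` is analytic and close to `1`. Then `z * U z` is a coordinate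
close enough to `z` for its square to keep a negative real part, of size comparable to `|z| ^ 2`, on
the imaginary axis. The constant `1 / 8` is only chosen small enough for the estimates below. -/
structure IsCoordinate (U : ℂ → ℂ) (δ : ℝ) : Prop where
  pos : 0 < δ
  analytic : ∀ z ∈ Metric.closedBall (0 : ℂ) δ, AnalyticAt ℂ U z
  close : ∀ z ∈ Metric.closedBall (0 : ℂ) δ, ‖U z - 1‖ ≤ 1 / 8

theorem I_mul_mem_closedBall {θ : ℝ} (h : |θ| ≤ δ) : I * (θ : ℂ) ∈ Metric.closedBall (0 : ℂ) δ := by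
  simpa using h

theorem one_half_le_re_sq {w : ℂ} (hw : ‖w - 1‖ ≤ 1 / 8) : 1 / 2 ≤ (w ^ 2).re := by
  have h1 : ‖w ^ 2 - 1‖ ≤ 1 / 2 := by
    have e : w ^ 2 - 1 = (w - 1) * (w - 1 + 2) := by ring
    have h2 : ‖w - 1 + 2‖ ≤ 1 / 8 + 2 := (norm_add_le _ _).trans (by simpa using hw)
    rw [e, norm_mul]
    nlinarith [norm_nonneg (w - 1), norm_nonneg (w - 1 + 2)]
  have h3 := (abs_le.1 ((abs_re_le_norm (w ^ 2 - 1)).trans h1)).1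
  simp only [sub_re, one_re] at h3
  linarith

namespace IsCoordinate

/-- Gaussian decay of the integrand on the imaginary segment. -/
theorem norm_exp_le (hU : IsCoordinate U δ) (hs : 0 < s) (n : ℕ) {θ : ℝ} (h : |θ| ≤ δ) :
    ‖exp (n * s / 2 * (I * θ * U (I * θ)) ^ 2)‖ ≤ Real.exp (-(n * s * θ ^ 2 / 4)) := by
  rw [norm_exp, Real.exp_le_exp]
  have h1 := one_half_le_re_sq (hU.close _ (I_mul_mem_closedBall h))
  have e : (n * s / 2 * (I * θ * U (I * θ)) ^ 2 : ℂ) =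
      ((-(n * s * θ ^ 2 / 2) : ℝ) : ℂ) * U (I * θ) ^ 2 := by
    push_cast
    rw [mul_pow, mul_pow, I_sq]; ring
  rw [e, re_ofReal_mul]
  have h2 : 0 ≤ n * s * θ ^ 2 / 2 := by positivity
  nlinarith

theorem hasDerivAt (hU : IsCoordinate U δ) {θ : ℝ} (h : |θ| ≤ δ) :
    HasDerivAt (fun x : ℝ => I * x * U (I * x)) (I * deriv (fun z => z * U z) (I * θ)) θ := by
  have ha := hU.analytic _ (I_mul_mem_closedBall h)
  have h1 : HasDerivAt (fun z => z * U z) (deriv (fun z => z * U z) (I * θ)) (I * θ) :=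
    ((analyticAt_id.fun_mul ha).differentiableAt).hasDerivAt
  have h2 : HasDerivAt (fun x : ℝ => I * (x : ℂ)) I θ := by
    simpa using (ofRealCLM.hasDerivAt (x := θ)).const_mul I
  have := h1.comp_of_eq θ h2 rfl
  rw [mul_comm]
  exact this

theorem continuousOn_comp {F : ℂ → ℂ} (hF : ∀ z ∈ Metric.closedBall (0 : ℂ) δ, AnalyticAt ℂ F z) :
    ContinuousOn (fun θ : ℝ => F (I * θ)) (Set.Icc (-δ) δ) := by
  intro θ hθ
  have h1 := (hF _ (I_mul_mem_closedBall (abs_le.2 hθ))).continuousAt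
  have h2 : ContinuousAt (fun θ : ℝ => I * (θ : ℂ)) θ := by fun_prop
  exact (ContinuousAt.comp (f := fun θ : ℝ => I * (θ : ℂ)) h1 h2).continuousWithinAt

theorem analyticAt_coord (hU : IsCoordinate U δ) {z : ℂ} (hz : z ∈ Metric.closedBall (0 : ℂ) δ) :
    AnalyticAt ℂ (fun z => z * U z) z := analyticAt_id.fun_mul (hU.analytic z hz)

theorem intervalIntegrable (hU : IsCoordinate U δ) {F : ℂ → ℂ}
    (hF : ∀ z ∈ Metric.closedBall (0 : ℂ) δ, AnalyticAt ℂ F z) (n : ℕ) :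
    IntervalIntegrable (fun θ : ℝ => F (I * θ) * exp (n * s / 2 * (I * θ * U (I * θ)) ^ 2))
      volume (-δ) δ := by
  apply ContinuousOn.intervalIntegrable
  rw [Set.uIcc_of_le (by linarith [hU.pos])]
  refine continuousOn_comp (F := fun z => F z * exp (n * s / 2 * (z * U z) ^ 2)) fun z hz => ?_
  exact (hF z hz).fun_mul ((analyticAt_const.fun_mul ((hU.analyticAt_coord hz).fun_pow 2)).cexp)

end IsCoordinate

/-- The `k`-th moment `∫ u ^ k exp (n s u ^ 2 / 2) du / i` in the coordinate `u = z * U z`, along the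
segment `z = i θ` with `|θ| ≤ δ`. -/
noncomputable def moment (U : ℂ → ℂ) (δ s : ℝ) (k n : ℕ) : ℂ :=
  ∫ θ in (-δ)..δ, (I * θ * U (I * θ)) ^ k * deriv (fun z => z * U z) (I * θ) *
    exp (n * s / 2 * (I * θ * U (I * θ)) ^ 2)

namespace IsCoordinate

theorem moment_intervalIntegrable (hU : IsCoordinate U δ) (k n : ℕ) :
    IntervalIntegrable (fun θ : ℝ => (I * θ * U (I * θ)) ^ k * deriv (fun z => z * U z) (I * θ) *
      exp (n * s / 2 * (I * θ * U (I * θ)) ^ 2)) volume (-δ) δ :=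
  hU.intervalIntegrable (F := fun z => (z * U z) ^ k * deriv (fun z => z * U z) z)
    (fun _ hz => ((hU.analyticAt_coord hz).fun_pow k).fun_mul (hU.analyticAt_coord hz).deriv) n

/-- Integration by parts: the moments satisfy the recursion of Gaussian moments up to the boundary
terms, which are exponentially small. For `k = 0` the factor `k` hides the meaningless index
`k - 1`. -/
theorem moment_succ_isBigO (hU : IsCoordinate U δ) (hs : 0 < s) (k : ℕ) :
    (fun n : ℕ => n * s * moment U δ s (k + 1) n + k * moment U δ s (k - 1) n)
      =O[atTop] fun n : ℕ => Real.exp (-(s * δ ^ 2 / 4 * n)) := by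
  have hδ := hU.pos
  set B : ℝ → ℕ → ℂ := fun θ n =>
    (I * θ * U (I * θ)) ^ k * exp (n * s / 2 * (I * θ * U (I * θ)) ^ 2) with hB
  have key (n : ℕ) : I * (n * s * moment U δ s (k + 1) n + k * moment U δ s (k - 1) n) =
      B δ n - B (-δ) n := by
    rw [moment, moment, ← intervalIntegral.integral_const_mul,
      ← intervalIntegral.integral_const_mul, ← intervalIntegral.integral_add
        ((hU.moment_intervalIntegrable _ n).const_mul _)
        ((hU.moment_intervalIntegrable _ n).const_mul _),
      ← intervalIntegral.integral_const_mul]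
    refine intervalIntegral.integral_eq_sub_of_hasDerivAt (f := fun θ => B θ n) ?_ ?_
    · intro θ hθ
      rw [Set.uIcc_of_le (by linarith)] at hθ
      have h1 := hU.hasDerivAt (abs_le.2 hθ)
      have h2 := (h1.fun_pow k).fun_mul ((h1.fun_pow 2).const_mul (n * s / 2 : ℂ)).cexp
      refine h2.congr_deriv ?_
      simp only [Nat.cast_ofNat, pow_succ, Nat.reduceSub]
      ring
    · exact (((hU.moment_intervalIntegrable _ n).const_mul _).add
        ((hU.moment_intervalIntegrable _ n).const_mul _)).const_mul _
  have hbd (θ : ℝ) (hθ : |θ| = δ) (n : ℕ) :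
      ‖B θ n‖ ≤ ‖(I * θ * U (I * θ)) ^ k‖ * Real.exp (-(s * δ ^ 2 / 4 * n)) := by
    rw [hB]
    simp only [norm_mul _ (exp _)]
    refine mul_le_mul_of_nonneg_left ((hU.norm_exp_le hs n hθ.le).trans_eq ?_) (norm_nonneg _)
    rw [← hθ, sq_abs]; congr 1; ring
  refine IsBigO.of_bound (‖(I * δ * U (I * δ)) ^ k‖ +
    ‖(I * (-δ : ℝ) * U (I * (-δ : ℝ))) ^ k‖) (Eventually.of_forall fun n => ?_)
  have h1 : ‖(n * s * moment U δ s (k + 1) n + k * moment U δ s (k - 1) n)‖ =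
      ‖B δ n - B (-δ) n‖ := by rw [← key, norm_mul, norm_I, one_mul]
  rw [h1, Real.norm_of_nonneg (Real.exp_pos _).le, add_mul]
  exact (norm_sub_le _ _).trans (add_le_add (hbd _ (abs_of_pos hδ) n)
    (hbd _ (by rw [abs_neg, abs_of_pos hδ]) n))

end IsCoordinate

theorem gaussian_tail_isBigO (hs : 0 < s) (hδ : 0 < δ) :
    (fun n : ℕ => (∫ θ in (-δ)..δ, Real.exp (-(n * s / 2) * θ ^ 2)) -
      √(2 * Real.pi / (n * s))) =O[atTop] fun n : ℕ => Real.exp (-(s * δ ^ 2 / 4 * n)) := by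
  refine IsBigO.of_bound (Real.exp (s * δ ^ 2 / 2) * √(Real.pi / (s / 2))) ?_
  filter_upwards [eventually_ge_atTop 1] with n hn
  have hn' : (1 : ℝ) ≤ n := by exact_mod_cast hn
  have hb : 0 < (n : ℝ) * s / 2 := by positivity
  have hint := integrable_exp_neg_mul_sq hb
  have hint1 := integrable_exp_neg_mul_sq (half_pos hs)
  have e1 : √(2 * Real.pi / (n * s)) = ∫ θ : ℝ, Real.exp (-(n * s / 2) * θ ^ 2) := by
    rw [integral_gaussian]
    congr 1
    field_simp
  rw [e1, intervalIntegral.integral_of_le (by linarith),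
    ← integral_add_compl (measurableSet_Ioc (a := -δ) (b := δ)) hint, sub_add_cancel_left,
    norm_neg, Real.norm_of_nonneg (integral_nonneg fun _ => (Real.exp_pos _).le),
    Real.norm_of_nonneg (Real.exp_pos _).le]
  calc ∫ θ in (Set.Ioc (-δ) δ)ᶜ, Real.exp (-(n * s / 2) * θ ^ 2)
      ≤ ∫ θ in (Set.Ioc (-δ) δ)ᶜ, Real.exp (-((n - 1) * s / 2 * δ ^ 2)) *
          Real.exp (-(s / 2) * θ ^ 2) := by
        refine setIntegral_mono_on hint.integrableOn (hint1.const_mul _).integrableOn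
          measurableSet_Ioc.compl fun θ hθ => ?_
        rw [← Real.exp_add, Real.exp_le_exp]
        -- outside the interval, `n - 1` of the `n` factors are at most their value at `δ`
        have h1 : δ ^ 2 ≤ θ ^ 2 := by
          simp only [Set.mem_compl_iff, Set.mem_Ioc, not_and_or, not_lt, not_le] at hθ
          rcases hθ with h | h <;> nlinarith
        have h2 : 0 ≤ ((n : ℝ) - 1) * s / 2 := by
          have : 0 ≤ (n : ℝ) - 1 := by linarith
          positivity
        nlinarith
    _ ≤ ∫ θ : ℝ, Real.exp (-((n - 1) * s / 2 * δ ^ 2)) * Real.exp (-(s / 2) * θ ^ 2) :=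
        setIntegral_le_integral (hint1.const_mul _) (Eventually.of_forall fun θ => by positivity)
    _ = Real.exp (-((n - 1) * s / 2 * δ ^ 2)) * √(Real.pi / (s / 2)) := by
        rw [integral_const_mul, integral_gaussian]
    _ ≤ Real.exp (s * δ ^ 2 / 2) * √(Real.pi / (s / 2)) * Real.exp (-(s * δ ^ 2 / 4 * n)) := by
        rw [mul_right_comm, ← Real.exp_add]
        gcongr
        nlinarith [mul_pos hs (pow_pos hδ 2)]

namespace IsCoordinate

/-- The Gaussian `exp (n s z ^ 2 / 2)` has a primitive, so the moment of order zero depends only on the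
end points `u (± i δ)` of its path. Moving these to `± i δ` costs an exponentially small amount,
and what is left is the real Gaussian integral. -/
theorem moment_zero_isBigO (hU : IsCoordinate U δ) (hs : 0 < s) :
    (fun n : ℕ => moment U δ s 0 n - ((√(2 * Real.pi / (n * s)) : ℝ) : ℂ))
      =O[atTop] fun n : ℕ => Real.exp (-(s * δ ^ 2 / 4 * n)) := by
  have hδ := hU.pos
  have hW (n : ℕ) : ∃ W : ℂ → ℂ, ∀ z ∈ Metric.ball (0 : ℂ) (2 * δ),
      HasDerivAt W (exp (n * s / 2 * z ^ 2)) z := by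
    have hd : DifferentiableOn ℂ (fun z : ℂ => exp (n * s / 2 * z ^ 2))
      (Metric.ball (0 : ℂ) (2 * δ)) := by fun_prop
    exact hd.isExactOn_ball
  choose W hW using hW
  have hend (θ : ℝ) (hθ : |θ| = δ) (n : ℕ) : ‖W n (I * θ * U (I * θ)) - W n (I * θ)‖ ≤
      Real.exp (-(s * δ ^ 2 / 4 * n)) * (δ / 8) := by
    have hθ2 : θ ^ 2 = δ ^ 2 := by rw [← hθ, sq_abs]
    have hdist : ‖I * θ * U (I * θ) - I * θ‖ ≤ δ / 8 := by
      rw [show I * θ * U (I * θ) - I * θ = I * θ * (U (I * θ) - 1) by ring, norm_mul, norm_mul,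
        norm_I, one_mul, norm_real, Real.norm_eq_abs, hθ]
      have := hU.close _ (I_mul_mem_closedBall hθ.le)
      nlinarith
    have hmem : ∀ z ∈ Metric.closedBall (I * θ) (δ / 8), z ∈ Metric.ball (0 : ℂ) (2 * δ) := by
      intro z hz
      rw [mem_closedBall_iff_norm] at hz
      have h1 : ‖I * (θ : ℂ)‖ = δ := by simpa using hθ
      have h2 : ‖z‖ ≤ ‖z - I * θ‖ + ‖I * (θ : ℂ)‖ := by
        simpa using norm_add_le (z - I * θ) (I * θ)
      rw [mem_ball_zero_iff]
      linarith
    have hbound : ∀ z ∈ Metric.closedBall (I * θ) (δ / 8), ‖exp (n * s / 2 * z ^ 2)‖ ≤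
        Real.exp (-(s * δ ^ 2 / 4 * n)) := by
      intro z hz
      rw [mem_closedBall_iff_norm] at hz
      rw [norm_exp, Real.exp_le_exp]
      have h1 : |z.re| ≤ δ / 8 := by
        have := (abs_re_le_norm (z - I * θ)).trans hz
        simpa using this
      have h2 : |z.im - θ| ≤ δ / 8 := by
        have := (abs_im_le_norm (z - I * θ)).trans hz
        simpa using this
      have e : ((n : ℂ) * s / 2 * z ^ 2).re = n * s / 2 * (z.re ^ 2 - z.im ^ 2) := by
        rw [show (n : ℂ) * s / 2 * z ^ 2 = ((n * s / 2 : ℝ) : ℂ) * z ^ 2 by push_cast; ring,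
          re_ofReal_mul, sq, mul_re]
        ring
      rw [e]
      have h3 : z.re ^ 2 ≤ (δ / 8) ^ 2 := sq_le_sq' (abs_le.1 h1).1 (abs_le.1 h1).2
      have h4 : 7 / 8 * δ ≤ |z.im| := by
        have := abs_sub_abs_le_abs_sub θ z.im
        rw [hθ, abs_sub_comm] at this
        linarith
      have h5 : (7 / 8 * δ) ^ 2 ≤ z.im ^ 2 := by
        rw [← sq_abs z.im]
        exact pow_le_pow_left₀ (by positivity) h4 2
      have h6 : z.re ^ 2 - z.im ^ 2 ≤ -(δ ^ 2 / 2) := by nlinarith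
      have h7 : 0 ≤ (n : ℝ) * s / 2 := by positivity
      nlinarith
    have hc := (convex_closedBall (I * (θ : ℂ)) (δ / 8)).norm_image_sub_le_of_norm_hasDerivWithin_le
      (fun z hz => (hW n z (hmem z hz)).hasDerivWithinAt) hbound
      (Metric.mem_closedBall_self (by positivity)) (mem_closedBall_iff_norm.2 hdist)
    exact hc.trans (mul_le_mul_of_nonneg_left hdist (Real.exp_pos _).le)
  have hmom (n : ℕ) : I * moment U δ s 0 n =
      W n (I * δ * U (I * δ)) - W n (I * (-δ : ℝ) * U (I * (-δ : ℝ))) := by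
    rw [moment, ← intervalIntegral.integral_const_mul]
    refine intervalIntegral.integral_eq_sub_of_hasDerivAt
      (f := fun θ : ℝ => W n (I * θ * U (I * θ))) ?_ ((hU.moment_intervalIntegrable 0 n).const_mul _)
    intro θ hθ
    rw [Set.uIcc_of_le (by linarith)] at hθ
    have hθ' := abs_le.2 hθ
    have hmem : I * θ * U (I * θ) ∈ Metric.ball (0 : ℂ) (2 * δ) := by
      have h1 := hU.close _ (I_mul_mem_closedBall hθ')
      have h2 : ‖U (I * θ)‖ ≤ 1 / 8 + 1 := by
        have := norm_add_le (U (I * θ) - 1) 1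
        simp only [sub_add_cancel, norm_one] at this
        linarith
      rw [mem_ball_zero_iff, norm_mul, norm_mul, norm_I, one_mul, norm_real, Real.norm_eq_abs]
      nlinarith [abs_nonneg θ, norm_nonneg (U (I * θ))]
    refine HasDerivAt.congr_deriv
      (HasDerivAt.scomp_of_eq (h := fun x : ℝ => I * x * U (I * x)) θ (hW n _ hmem)
        (hU.hasDerivAt hθ') rfl) ?_
    simp only [pow_zero, one_mul, smul_eq_mul]
    ring
  have hgauss (n : ℕ) : I * ((∫ θ in (-δ)..δ, Real.exp (-(n * s / 2) * θ ^ 2) : ℝ) : ℂ) =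
      W n (I * δ) - W n (I * (-δ : ℝ)) := by
    rw [← intervalIntegral.integral_ofReal, ← intervalIntegral.integral_const_mul]
    refine intervalIntegral.integral_eq_sub_of_hasDerivAt
      (f := fun θ : ℝ => W n (I * θ)) ?_ (Continuous.intervalIntegrable (by fun_prop) _ _)
    intro θ hθ
    rw [Set.uIcc_of_le (by linarith)] at hθ
    have hmem : I * (θ : ℂ) ∈ Metric.ball (0 : ℂ) (2 * δ) := by
      have := abs_le.2 hθ
      rw [mem_ball_zero_iff, norm_mul, norm_I, one_mul, norm_real, Real.norm_eq_abs]
      linarith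
    have h2 : HasDerivAt (fun x : ℝ => I * (x : ℂ)) I θ := by
      simpa using (ofRealCLM.hasDerivAt (x := θ)).const_mul I
    refine HasDerivAt.congr_deriv
      (HasDerivAt.scomp_of_eq (h := fun x : ℝ => I * (x : ℂ)) θ (hW n _ hmem) h2 rfl) ?_
    rw [smul_eq_mul, mul_pow, I_sq]
    push_cast
    congr 2
    ring
  have h1 : (fun n : ℕ => moment U δ s 0 n -
      ((∫ θ in (-δ)..δ, Real.exp (-(n * s / 2) * θ ^ 2) : ℝ) : ℂ))
      =O[atTop] fun n : ℕ => Real.exp (-(s * δ ^ 2 / 4 * n)) := by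
    refine IsBigO.of_bound (δ / 4) (Eventually.of_forall fun n => ?_)
    have e : ‖moment U δ s 0 n -
        ((∫ θ in (-δ)..δ, Real.exp (-(n * s / 2) * θ ^ 2) : ℝ) : ℂ)‖ =
        ‖(W n (I * δ * U (I * δ)) - W n (I * δ)) -
          (W n (I * (-δ : ℝ) * U (I * (-δ : ℝ))) - W n (I * (-δ : ℝ)))‖ := by
      rw [sub_sub_sub_comm, ← hmom, ← hgauss, ← mul_sub, norm_mul, norm_I, one_mul]
    rw [e, Real.norm_of_nonneg (Real.exp_pos _).le]
    refine (norm_sub_le _ _).trans ((add_le_add (hend δ (abs_of_pos hδ) n)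
      (hend (-δ) (by rw [abs_neg, abs_of_pos hδ]) n)).trans_eq (by ring))
  have h2 := (gaussian_tail_isBigO hs hδ)
  have h3 := h1.add ((isBigO_norm_left.1 (by
    have := isBigO_norm_left.2 h2
    simpa only [← norm_real] using this)) : (fun n : ℕ => (((∫ θ in (-δ)..δ,
      Real.exp (-(n * s / 2) * θ ^ 2)) - √(2 * Real.pi / (n * s)) : ℝ) : ℂ)) =O[atTop] _)
  refine h3.congr_left fun n => ?_
  push_cast
  ring

end IsCoordinate

theorem exp_neg_isBigO {c : ℝ} (hc : 0 < c) (M : ℕ) :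
    (fun n : ℕ => Real.exp (-(c * n))) =O[atTop] fun n : ℕ => (√n)⁻¹ * ((n : ℝ) ^ M)⁻¹ := by
  refine IsBigO.of_bound ((M + 1)! / c ^ (M + 1)) ?_
  filter_upwards [eventually_ge_atTop 1] with n hn
  have hn' : (1 : ℝ) ≤ n := by exact_mod_cast hn
  have hn0 : (0 : ℝ) < n := by linarith
  have h1 := Real.pow_div_factorial_le_exp (c * n) (by positivity) (M + 1)
  have h2 : √(n : ℝ) ≤ n := by
    rw [Real.sqrt_le_left hn0.le]; nlinarith
  rw [Real.norm_of_nonneg (Real.exp_pos _).le, Real.norm_of_nonneg (by positivity)]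
  calc Real.exp (-(c * n)) = (Real.exp (c * n))⁻¹ := Real.exp_neg _
    _ ≤ ((c * n) ^ (M + 1) / (M + 1)!)⁻¹ := inv_anti₀ (by positivity) h1
    _ = (M + 1)! / c ^ (M + 1) * ((n : ℝ)⁻¹ * ((n : ℝ) ^ M)⁻¹) := by
        rw [mul_pow, pow_succ (n : ℝ)]
        field_simp
    _ ≤ _ := by gcongr

theorem inv_natCast_mul_isBigO_one (s : ℝ) :
    (fun n : ℕ => ((n : ℂ) * s)⁻¹) =O[atTop] fun _ : ℕ => (1 : ℝ) := by
  refine IsBigO.of_bound ‖(s : ℂ)⁻¹‖ ?_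
  filter_upwards [eventually_ge_atTop 1] with n hn
  have hn' : (1 : ℝ) ≤ n := by exact_mod_cast hn
  rw [mul_inv, norm_mul, norm_inv (n : ℂ), Complex.norm_natCast, norm_one, mul_one]
  exact mul_le_of_le_one_left (norm_nonneg _) (inv_le_one_of_one_le₀ hn')

namespace IsCoordinate

theorem moment_succ_succ_sub_isBigO (hU : IsCoordinate U δ) (hs : 0 < s) (k : ℕ) {a : ℕ → ℂ}
    (ha : (fun n => moment U δ s k n - a n)
      =O[atTop] fun n : ℕ => Real.exp (-(s * δ ^ 2 / 4 * n))) :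
    (fun n => moment U δ s (k + 2) n - -((k : ℂ) + 1) / (n * s) * a n)
      =O[atTop] fun n : ℕ => Real.exp (-(s * δ ^ 2 / 4 * n)) := by
  have h1 := (hU.moment_succ_isBigO hs (k + 1)).sub (ha.const_mul_left ((k : ℂ) + 1))
  have h2 := (inv_natCast_mul_isBigO_one s).mul h1
  simp only [one_mul] at h2
  refine h2.congr' ?_ EventuallyEq.rfl
  filter_upwards [eventually_ge_atTop 1] with n hn
  have hn0 : (n : ℂ) ≠ 0 := by exact_mod_cast (by omega : n ≠ 0)
  have hs0 : (s : ℂ) ≠ 0 := by exact_mod_cast hs.ne'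
  simp only [Nat.add_sub_cancel]
  push_cast
  field_simp
  ring

/-- Odd moments start the recursion from nothing, so only boundary terms contribute. -/
theorem moment_odd_isBigO (hU : IsCoordinate U δ) (hs : 0 < s) (m : ℕ) :
    (fun n => moment U δ s (2 * m + 1) n)
      =O[atTop] fun n : ℕ => Real.exp (-(s * δ ^ 2 / 4 * n)) := by
  induction m with
  | zero =>
    have h2 := (inv_natCast_mul_isBigO_one s).mul (hU.moment_succ_isBigO hs 0)
    simp only [one_mul] at h2
    refine h2.congr' ?_ EventuallyEq.rfl
    filter_upwards [eventually_ge_atTop 1] with n hn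
    have hn0 : (n : ℂ) ≠ 0 := by exact_mod_cast (by omega : n ≠ 0)
    have hs0 : (s : ℂ) ≠ 0 := by exact_mod_cast hs.ne'
    simp only [Nat.cast_zero, zero_mul, add_zero, mul_zero]
    field_simp
  | succ m ih =>
    have := hU.moment_succ_succ_sub_isBigO hs (2 * m + 1) (a := fun _ => 0) (by simpa using ih)
    simpa only [mul_zero, sub_zero, show 2 * (m + 1) + 1 = 2 * m + 1 + 2 by ring] using this

/-- Even moments are the Gaussian moments `(-1) ^ m (2m - 1)!! (s n) ^ (-m)`, up to an exponentially
small error. -/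
theorem moment_even_isBigO (hU : IsCoordinate U δ) (hs : 0 < s) (m : ℕ) :
    (fun n : ℕ => moment U δ s (2 * m) n - ((√(2 * Real.pi / (n * s)) : ℝ) : ℂ) *
      (((-1) ^ m * ((2 * m)! : ℂ) / (2 ^ m * (m ! : ℂ))) * (((s : ℂ) * n) ^ m)⁻¹))
      =O[atTop] fun n : ℕ => Real.exp (-(s * δ ^ 2 / 4 * n)) := by
  induction m with
  | zero => simpa using hU.moment_zero_isBigO hs
  | succ m ih =>
    refine (hU.moment_succ_succ_sub_isBigO hs (2 * m) ih).congr' ?_ EventuallyEq.rfl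
    filter_upwards [eventually_ge_atTop 1] with n hn
    have hn0 : (n : ℂ) ≠ 0 := by exact_mod_cast (by omega : n ≠ 0)
    have hs0 : (s : ℂ) ≠ 0 := by exact_mod_cast hs.ne'
    have hm0 : (m : ℂ) + 1 ≠ 0 := Nat.cast_add_one_ne_zero m
    have hf : (m ! : ℂ) ≠ 0 := by exact_mod_cast m.factorial_ne_zero
    rw [show 2 * (m + 1) = 2 * m + 1 + 1 by ring, Nat.factorial_succ (2 * m + 1),
      Nat.factorial_succ (2 * m), Nat.factorial_succ m]
    congr 1
    push_cast
    simp only [pow_succ]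
    field_simp
    ring

/-- A remainder of order `z ^ (2M)` contributes `O(n ^ (-M - 1/2))`: half of the Gaussian decay absorbs
the power of `θ`, the other half is integrated. -/
theorem remainder_isBigO (hU : IsCoordinate U δ) (hs : 0 < s) {r : ℂ → ℂ}
    (hr : ∀ z ∈ Metric.closedBall (0 : ℂ) δ, AnalyticAt ℂ r z) (M : ℕ) :
    (fun n : ℕ => ∫ θ in (-δ)..δ, (I * θ) ^ (2 * M) * r (I * θ) *
      exp (n * s / 2 * (I * θ * U (I * θ)) ^ 2))
      =O[atTop] fun n : ℕ => (√n)⁻¹ * ((n : ℝ) ^ M)⁻¹ := by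
  have hδ := hU.pos
  obtain ⟨C, hC⟩ := isCompact_Icc.exists_bound_of_continuousOn (continuousOn_comp hr)
  have hC0 : 0 ≤ C := (norm_nonneg _).trans (hC 0 ⟨by linarith, hδ.le⟩)
  refine IsBigO.of_bound (C * (M ! * (8 / s) ^ M) * √(Real.pi / (s / 8))) ?_
  filter_upwards [eventually_ge_atTop 1] with n hn
  have hn0 : (0 : ℝ) < n := by exact_mod_cast hn
  have hint := integrable_exp_neg_mul_sq (b := n * s / 8) (by positivity)
  have hpt (θ : ℝ) (hθ : θ ∈ Set.Ioc (-δ) δ) : ‖(I * θ) ^ (2 * M) * r (I * θ) *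
      exp (n * s / 2 * (I * θ * U (I * θ)) ^ 2)‖ ≤
      C * (M ! * (8 / s) ^ M) * ((n : ℝ) ^ M)⁻¹ * Real.exp (-(n * s / 8) * θ ^ 2) := by
    have hθ' : θ ∈ Set.Icc (-δ) δ := Set.Ioc_subset_Icc_self hθ
    have h1 := hU.norm_exp_le hs n (abs_le.2 hθ')
    have h2 := Real.pow_div_factorial_le_exp (n * s / 8 * θ ^ 2) (by positivity) M
    have h3 : θ ^ (2 * M) ≤
        M ! * (8 / s) ^ M * ((n : ℝ) ^ M)⁻¹ * Real.exp (n * s / 8 * θ ^ 2) := by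
      have e : θ ^ (2 * M) = M ! * (8 / s) ^ M * ((n : ℝ) ^ M)⁻¹ *
          ((n * s / 8 * θ ^ 2) ^ M / M !) := by
        rw [pow_mul, mul_pow, div_pow, div_pow, mul_pow]
        field_simp
      rw [e]
      gcongr
    rw [norm_mul, norm_mul, norm_pow, norm_mul, norm_I, one_mul, norm_real, Real.norm_eq_abs,
      pow_mul, sq_abs, ← pow_mul]
    calc θ ^ (2 * M) * ‖r (I * θ)‖ * ‖exp (n * s / 2 * (I * θ * U (I * θ)) ^ 2)‖
        ≤ (M ! * (8 / s) ^ M * ((n : ℝ) ^ M)⁻¹ * Real.exp (n * s / 8 * θ ^ 2)) * C *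
          Real.exp (-(n * s * θ ^ 2 / 4)) := by
          have h0 : 0 ≤ θ ^ (2 * M) := by rw [pow_mul]; positivity
          have := hC θ hθ'
          gcongr
      _ = C * (M ! * (8 / s) ^ M) * ((n : ℝ) ^ M)⁻¹ *
          (Real.exp (n * s / 8 * θ ^ 2) * Real.exp (-(n * s * θ ^ 2 / 4))) := by ring
      _ = _ := by rw [← Real.exp_add]; congr 2; ring
  have h1 := intervalIntegral.norm_integral_le_of_norm_le (by linarith : -δ ≤ δ)
    (Eventually.of_forall hpt) (hint.const_mul _).intervalIntegrable
  have hmul0 : 0 ≤ C * (M ! * (8 / s) ^ M) * ((n : ℝ) ^ M)⁻¹ := by positivity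
  rw [Real.norm_of_nonneg (by positivity)]
  refine h1.trans ?_
  rw [intervalIntegral.integral_of_le (by linarith)]
  refine (setIntegral_le_integral (hint.const_mul _)
    (Eventually.of_forall fun θ => mul_nonneg hmul0 (Real.exp_pos _).le)).trans_eq ?_
  rw [integral_const_mul, integral_gaussian,
    show Real.pi / (n * s / 8) = Real.pi / (s / 8) / n by field_simp,
    Real.sqrt_div (by positivity)]
  ring

/-- Laplace expansion over the short segment: integrate the expansion of `F` in the coordinate term by
term. The odd terms drop out. -/
theorem integral_isBigO (hU : IsCoordinate U δ) (hs : 0 < s) {F r : ℂ → ℂ}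
    (hr : ∀ z ∈ Metric.closedBall (0 : ℂ) δ, AnalyticAt ℂ r z) (M : ℕ) (c : ℕ → ℂ)
    (hexp : ∀ z ∈ Metric.closedBall (0 : ℂ) δ, F z - ∑ k ∈ Finset.range (2 * M),
      c k * ((z * U z) ^ k * deriv (fun z => z * U z) z) = z ^ (2 * M) * r z) :
    (fun n : ℕ => (∫ θ in (-δ)..δ, F (I * θ) * exp (n * s / 2 * (I * θ * U (I * θ)) ^ 2)) -
      ((√(2 * Real.pi / (n * s)) : ℝ) : ℂ) * ∑ m ∈ Finset.range M, c (2 * m) *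
        ((-1) ^ m * ((2 * m)! : ℂ) / (2 ^ m * (m ! : ℂ))) * (((s : ℂ) * n) ^ m)⁻¹)
      =O[atTop] fun n : ℕ => (√n)⁻¹ * ((n : ℝ) ^ M)⁻¹ := by
  have hδ := hU.pos
  have hsplit (n : ℕ) :
      (∫ θ in (-δ)..δ, F (I * θ) * exp (n * s / 2 * (I * θ * U (I * θ)) ^ 2)) =
      (∫ θ in (-δ)..δ, (I * θ) ^ (2 * M) * r (I * θ) *
        exp (n * s / 2 * (I * θ * U (I * θ)) ^ 2)) +
      ∑ k ∈ Finset.range (2 * M), c k * moment U δ s k n := by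
    have hint (k : ℕ) (_ : k ∈ Finset.range (2 * M)) := (hU.moment_intervalIntegrable
      (s := s) k n).const_mul (c k)
    have hR := hU.intervalIntegrable (s := s) (F := fun z => z ^ (2 * M) * r z)
      (fun z hz => (analyticAt_id.fun_pow _).fun_mul (hr z hz)) n
    simp only [moment, ← intervalIntegral.integral_const_mul]
    rw [← intervalIntegral.integral_finsetSum hint,
      ← intervalIntegral.integral_add hR (IntervalIntegrable.sum _ hint |>.congr (by
        intro θ _; simp))]
    refine intervalIntegral.integral_congr fun θ hθ => ?_
    rw [Set.uIcc_of_le (by linarith)] at hθ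
    have := hexp _ (I_mul_mem_closedBall (abs_le.2 hθ))
    rw [← this, sub_mul, Finset.sum_mul, sub_add_eq_add_sub, eq_sub_iff_add_eq]
    congr 1
    exact Finset.sum_congr rfl fun k _ => by ring
  have hpair (a : ℕ → ℂ) : ∑ k ∈ Finset.range (2 * M), a k =
      ∑ m ∈ Finset.range M, (a (2 * m) + a (2 * m + 1)) := by
    clear hexp hsplit
    induction M with
    | zero => simp
    | succ M ih => rw [mul_add, Finset.sum_range_succ, Finset.sum_range_succ, ih,
        Finset.sum_range_succ, add_assoc]
  have hmom := IsBigO.sum (s := Finset.range M) fun m _ =>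
    ((hU.moment_even_isBigO hs m).const_mul_left (c (2 * m))).add
      ((hU.moment_odd_isBigO hs m).const_mul_left (c (2 * m + 1)))
  have hsmall := hmom.trans (exp_neg_isBigO (c := s * δ ^ 2 / 4) (by positivity) M)
  refine ((hU.remainder_isBigO hs hr M).add hsmall).congr_left fun n => ?_
  rw [hsplit, hpair, Finset.mul_sum, add_sub_assoc, ← Finset.sum_sub_distrib]
  rw [Finset.sum_apply]
  congr 1
  exact Finset.sum_congr rfl fun m _ => by ring

end IsCoordinate

end Laplace

/-! ### Consequences of nonnegative coefficients, and Cauchy's formula -/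

section PowerSeriesFacts

open Complex

theorem hasSum_taylorCoeff {G : ℂ → ℂ} {ρ : ℝ} (hG : AnalyticOnNhd ℂ G (Metric.ball 0 ρ)) {z : ℂ}
    (hz : ‖z‖ < ρ) : HasSum (fun j => taylorCoeff G j * z ^ j) (G z) := by
  have h := hasSum_taylorSeries_on_ball hG.differentiableOn (mem_ball_zero_iff.2 hz)
  refine h.congr_fun fun j => ?_
  simp only [taylorCoeff, sub_zero, smul_eq_mul]
  ring

theorem taylorCoeff_deriv (F : ℂ → ℂ) (j : ℕ) :
    taylorCoeff (deriv F) j = taylorCoeff F (j + 1) * (j + 1) := by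
  have := congrArg (PowerSeries.coeff j) (taylorPS_deriv F)
  rwa [PowerSeries.coeff_derivative, taylorPS, taylorPS, PowerSeries.coeff_mk,
    PowerSeries.coeff_mk] at this

namespace Subcritical

variable {G : ℂ → ℂ} {ρ : ℝ}

theorem coeff_zero_pos (hG : Subcritical G ρ) : 0 < taylorCoeff G 0 := by
  simpa [taylorCoeff] using hG.zero_pos

theorem term_nonneg (hG : Subcritical G ρ) {r : ℝ} (hr : 0 ≤ r) (j : ℕ) :
    0 ≤ taylorCoeff G j * (r : ℂ) ^ j :=
  mul_nonneg (hG.coeff_nonneg j) (pow_nonneg (by exact_mod_cast hr) j)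

theorem apply_pos (hG : Subcritical G ρ) {r : ℝ} (hr : 0 ≤ r) (hrρ : r < ρ) : 0 < G r := by
  have hs := hasSum_taylorCoeff hG.analytic (z := r) (by simpa [abs_of_nonneg hr] using hrρ)
  refine hG.coeff_zero_pos.trans_le ?_
  have := le_hasSum hs 0 fun j _ => hG.term_nonneg hr j
  simpa using this

theorem analyticAt (hG : Subcritical G ρ) {r : ℝ} (hr : 0 ≤ r) (hrρ : r < ρ) :
    AnalyticAt ℂ G r :=
  hG.analytic _ (by simpa [abs_of_nonneg hr] using hrρ)

/-- Compare power series: `R G' - G + G(0) = ∑_{j ≥ 2} (j - 1) a_j R ^ j`, which is at most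
`∑ j (j - 1) a_j R ^ j = R ^ 2 G''`. At a root of `R G' = G` this leaves `R ^ 2 G'' ≥ G(0) > 0`. -/
theorem sq_mul_deriv_deriv_pos (hG : Subcritical G ρ) {R : ℝ} (hR : 0 < R) (hRρ : R < ρ)
    (hroot : (R : ℂ) * deriv G R = G R) : 0 < (R : ℂ) ^ 2 * deriv (deriv G) R := by
  have hnorm : ‖(R : ℂ)‖ < ρ := by simpa [abs_of_pos hR] using hRρ
  have h0 := (hasSum_nat_add_iff' 2).2 (hasSum_taylorCoeff hG.analytic hnorm)
  have h1 := (hasSum_nat_add_iff' 1).2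
    ((hasSum_taylorCoeff hG.analytic.deriv hnorm).mul_left (R : ℂ))
  have h2 := (hasSum_taylorCoeff hG.analytic.deriv.deriv hnorm).mul_left ((R : ℂ) ^ 2)
  have h3 := hasSum_le (fun j => ?_) (h1.sub h0) h2
  · refine lt_of_lt_of_le ?_ h3
    simp only [Finset.sum_range_succ, Finset.sum_range_zero, taylorCoeff_deriv]
    convert hG.coeff_zero_pos using 1
    rw [hroot]
    push_cast
    ring
  · simp only [taylorCoeff_deriv]
    have e := hG.term_nonneg hR.le (j + 2)
    have e2 : 0 ≤ taylorCoeff G (j + 2) * (R : ℂ) ^ (j + 2) * (((j : ℂ) + 1) ^ 2) :=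
      mul_nonneg e (by exact_mod_cast (by positivity : (0 : ℝ) ≤ ((j : ℝ) + 1) ^ 2))
    rw [← sub_nonneg]
    convert e2 using 1
    push_cast
    ring

/-- Aperiodicity makes `R` the only point of maximal modulus on its circle: equality in the triangle
inequality would force `z ^ j = 1` for all exponents `j` of the series, hence `z = 1`. -/
theorem norm_apply_lt (hG : Subcritical G ρ) {R : ℝ} (hR : 0 < R) (hRρ : R < ρ) {z : ℂ}
    (hz : ‖z‖ = 1) (hz1 : z ≠ 1) : ‖G (R * z)‖ < (G R).re := by
  have hnorm : ‖(R : ℂ)‖ < ρ := by simpa [abs_of_pos hR] using hRρ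
  have hnorm' : ‖(R : ℂ) * z‖ < ρ := by rwa [norm_mul, hz, mul_one]
  obtain ⟨ω, hω, hωG⟩ : ∃ ω : ℂ, ‖ω‖ = 1 ∧ (‖G (R * z)‖ : ℂ) = ω * G (R * z) := by
    obtain ⟨ω, hω, h⟩ := Complex.exists_norm_eq_mul_self (G (R * z))
    exact ⟨ω, hω, h⟩
  have ha (j : ℕ) : taylorCoeff G j = ((taylorCoeff G j).re : ℂ) :=
    Complex.eq_re_of_ofReal_le (r := 0) (by simpa using hG.coeff_nonneg j)
  have ha0 (j : ℕ) : 0 ≤ (taylorCoeff G j).re := (Complex.nonneg_iff.1 (hG.coeff_nonneg j)).1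
  have hs : HasSum (fun j => (taylorCoeff G j).re * R ^ j) (G R).re := by
    refine (Complex.hasSum_re (hasSum_taylorCoeff hG.analytic hnorm)).congr_fun fun j => ?_
    rw [ha j, ← ofReal_pow, ← ofReal_mul, ofReal_re, ofReal_re]
  have hs' : HasSum (fun j => (taylorCoeff G j).re * R ^ j * (ω * z ^ j).re) ‖G (R * z)‖ := by
    have := Complex.hasSum_re ((hasSum_taylorCoeff hG.analytic hnorm').mul_left ω)
    rw [← hωG, ofReal_re] at this
    refine this.congr_fun fun j => ?_
    rw [ha j, ofReal_re, ← re_ofReal_mul]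
    congr 1
    push_cast
    ring
  have hre (j : ℕ) : (ω * z ^ j).re ≤ 1 := by
    refine (re_le_norm _).trans_eq ?_
    rw [norm_mul, norm_pow, hω, hz, one_pow, one_mul]
  have hle (j : ℕ) : (taylorCoeff G j).re * R ^ j * (ω * z ^ j).re ≤
      (taylorCoeff G j).re * R ^ j :=
    mul_le_of_le_one_right (mul_nonneg (ha0 j) (by positivity)) (hre j)
  have hone {w : ℂ} (hw : ‖w‖ = 1) (hw1 : w ≠ 1) : w.re < 1 := by
    refine lt_of_le_of_ne (hw ▸ re_le_norm w) fun h => hw1 ?_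
    have := Complex.re_eq_norm.1 (h.trans hw.symm)
    rw [← hw] at h
    apply Complex.ext
    · rw [h, hw, one_re]
    · rw [one_im]; exact (Complex.nonneg_iff.1 this).2.symm
  -- the exponent `0` fixes the phase `ω`; the other exponents then fix `z`
  obtain ⟨i, hi0, hi⟩ : ∃ i, 0 < taylorCoeff G i ∧ ω * z ^ i ≠ 1 := by
    by_contra! hcon
    have hω1 : ω = 1 := by simpa using hcon 0 hG.coeff_zero_pos
    have hdvd : orderOf z ∣ Nat.setGcd {j : ℕ | 0 < taylorCoeff G j} := by
      rw [Nat.dvd_setGcd_iff]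
      intro j hj
      exact orderOf_dvd_of_pow_eq_one (by simpa [hω1] using hcon j hj)
    rw [hG.aperiodic, Nat.dvd_one, orderOf_eq_one_iff] at hdvd
    exact hz1 hdvd
  refine hasSum_lt (i := i) hle ?_ hs' hs
  have hi0' : 0 < (taylorCoeff G i).re := (Complex.pos_iff.1 hi0).1
  exact mul_lt_of_lt_one_right (by positivity)
    (hone (by rw [norm_mul, norm_pow, hω, hz, one_pow, one_mul]) hi)

theorem eventually_hasDerivAt_logG (hG : Subcritical G ρ) {R : ℝ} (hR : 0 ≤ R) (hRρ : R < ρ) :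
    ∀ᶠ z in 𝓝 (R : ℂ), G z ≠ 0 ∧ HasDerivAt (logG G) (deriv G z / G z) z := by
  have ha := hG.analyticAt hR hRρ
  have hpos : G R ∈ slitPlane := Or.inl (Complex.pos_iff.1 (hG.apply_pos hR hRρ)).1
  filter_upwards [ha.continuousAt.eventually_mem (isOpen_slitPlane.mem_nhds hpos),
    ha.eventually_analyticAt] with z h1 h2
  exact ⟨slitPlane_ne_zero h1, h2.differentiableAt.hasDerivAt.clog h1⟩

theorem analyticAt_logG (hG : Subcritical G ρ) {R : ℝ} (hR : 0 ≤ R) (hRρ : R < ρ) :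
    AnalyticAt ℂ (logG G) R :=
  (hG.analyticAt hR hRρ).clog (Or.inl (Complex.pos_iff.1 (hG.apply_pos hR hRρ)).1)

theorem mul_deriv_logG_eq_one_iff (hG : Subcritical G ρ) {R : ℝ} (hR : 0 ≤ R) (hRρ : R < ρ) :
    (R : ℂ) * deriv (logG G) R = 1 ↔ (R : ℂ) * deriv G R = G R := by
  obtain ⟨h1, h2⟩ := (hG.eventually_hasDerivAt_logG hR hRρ).self_of_nhds
  rw [h2.deriv, ← mul_div_assoc, div_eq_one_iff_eq h1]

theorem sigmaSq_pos (hG : Subcritical G ρ) {R : ℝ} (hR : 0 < R) (hRρ : R < ρ)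
    (hroot : (R : ℂ) * deriv (logG G) R = 1) : 0 < sigmaSq (logG G) R := by
  have hroot' := (hG.mul_deriv_logG_eq_one_iff hR.le hRρ).1 hroot
  have hev := hG.eventually_hasDerivAt_logG hR.le hRρ
  obtain ⟨h1, h2⟩ := hev.self_of_nhds
  have ha := hG.analyticAt hR.le hRρ
  have h3 : deriv (logG G) =ᶠ[𝓝 (R : ℂ)] fun z => deriv G z / G z :=
    hev.mono fun z hz => hz.2.deriv
  have h4 : deriv (deriv (logG G)) R =
      (deriv (deriv G) R * G R - deriv G R * deriv G R) / G R ^ 2 := by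
    rw [h3.deriv_eq]
    exact (ha.deriv.differentiableAt.hasDerivAt.fun_div ha.differentiableAt.hasDerivAt h1).deriv
  have h5 : sigmaSq (logG G) R = (R : ℂ) ^ 2 * deriv (deriv G) R * (G R)⁻¹ := by
    rw [sigmaSq, hroot, h4]
    have e : (R : ℂ) ^ 2 * ((deriv (deriv G) R * G R - deriv G R * deriv G R) / G R ^ 2) =
      (R : ℂ) ^ 2 * deriv (deriv G) R * (G R)⁻¹ - (R * deriv G R) ^ 2 / G R ^ 2 := by
      field_simp
    rw [e, hroot', div_self (pow_ne_zero 2 h1)]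
    ring
  rw [h5]
  exact mul_pos (hG.sq_mul_deriv_deriv_pos hR hRρ hroot') (by
    have := hG.apply_pos hR.le hRρ
    exact inv_pos.2 this)

end Subcritical

/-- Cauchy's formula on the circle of radius `R`, written over the period `[-π, π]` centred at the
saddle point. -/
theorem taylorCoeff_pow_eq_integral {G : ℂ → ℂ} {ρ : ℝ} (hG : AnalyticOnNhd ℂ G (Metric.ball 0 ρ))
    {R : ℝ} (hR : 0 < R) (hRρ : R < ρ) (n : ℕ) :
    taylorCoeff (fun z => G z ^ (n + 1)) n = (R : ℂ) ^ (1 - ((n + 1 : ℕ) : ℤ)) / (2 * Real.pi) *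
      ∫ θ in (-Real.pi)..Real.pi,
        exp (I * θ) * (G (R * exp (I * θ)) * exp (-(I * θ))) ^ (n + 1) := by
  have hd : DifferentiableOn ℂ (fun z => G z ^ (n + 1)) (Metric.closedBall 0 R) :=
    (hG.differentiableOn.mono (Metric.closedBall_subset_ball hRρ)).fun_pow _
  have hC := hd.circleIntegral_one_div_sub_center_pow_smul hR n
  have hR0 : (R : ℂ) ≠ 0 := by exact_mod_cast hR.ne'
  have hπ : (Real.pi : ℂ) ≠ 0 := by exact_mod_cast Real.pi_ne_zero
  have hper : Function.Periodic (fun θ : ℝ =>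
      exp (I * θ) * (G (R * exp (I * θ)) * exp (-(I * θ))) ^ (n + 1)) (2 * Real.pi) := by
    intro θ
    have e1 : exp (I * ((θ + 2 * Real.pi : ℝ) : ℂ)) = exp (I * θ) := by
      rw [show I * ((θ + 2 * Real.pi : ℝ) : ℂ) = I * θ + 2 * Real.pi * I by push_cast; ring,
        exp_periodic]
    simp only [exp_neg, e1]
  have hshift := hper.intervalIntegral_add_eq (-Real.pi) 0
  rw [show -Real.pi + 2 * Real.pi = Real.pi by ring, zero_add] at hshift
  have hcirc : (∮ z in C(0, R), (1 / (z - 0) ^ (n + 1)) • G z ^ (n + 1)) =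
      I * (R : ℂ) ^ (1 - ((n + 1 : ℕ) : ℤ)) * ∫ θ in (0)..(2 * Real.pi),
        exp (I * θ) * (G (R * exp (I * θ)) * exp (-(I * θ))) ^ (n + 1) := by
    rw [circleIntegral, ← intervalIntegral.integral_const_mul]
    refine intervalIntegral.integral_congr fun θ _ => ?_
    have e : (θ : ℂ) * I = I * θ := mul_comm _ _
    simp only [deriv_circleMap, circleMap, zero_add, sub_zero, smul_eq_mul, e, exp_neg, mul_pow,
      inv_pow]
    rw [zpow_sub₀ hR0, zpow_one, zpow_natCast]
    field_simp
  rw [hcirc, ← hshift] at hC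
  generalize (∫ θ in (-Real.pi)..Real.pi,
    exp (I * θ) * (G (R * exp (I * θ)) * exp (-(I * θ))) ^ (n + 1)) = J at hC ⊢
  have hf : (n ! : ℂ) ≠ 0 := by exact_mod_cast n.factorial_ne_zero
  rw [smul_eq_mul] at hC
  rw [taylorCoeff]
  have h2 : (2 * Real.pi * I : ℂ) ≠ 0 := by simp [hπ]
  apply mul_left_cancel₀ h2
  rw [← mul_div_assoc, mul_div_right_comm, ← hC]
  field_simp

end PowerSeriesFacts

/-! ### The saddle-point expansion -/

section SaddlePoint

open Complex MeasureTheory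

namespace Subcritical

variable {G : ℂ → ℂ} {ρ : ℝ}

theorem continuous_circle (hG : Subcritical G ρ) {R : ℝ} (hR : 0 < R) (hRρ : R < ρ) :
    Continuous fun θ : ℝ => G (R * exp (I * θ)) := by
  rw [continuous_iff_continuousAt]
  intro θ
  have h1 : (R : ℂ) * exp (I * θ) ∈ Metric.ball (0 : ℂ) ρ := by
    rw [mem_ball_zero_iff, norm_mul, mul_comm I, norm_exp_ofReal_mul_I, norm_real,
      Real.norm_of_nonneg hR.le, mul_one]
    exact hRρ
  have h2 : ContinuousAt (fun θ : ℝ => (R : ℂ) * exp (I * θ)) θ := by fun_prop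
  exact ContinuousAt.comp (f := fun θ : ℝ => (R : ℂ) * exp (I * θ))
    (hG.analytic _ h1).continuousAt h2

/-- By compactness, the strict inequality of `norm_apply_lt` is uniform away from the saddle point. -/
theorem exists_ratio_le_of_away (hG : Subcritical G ρ) {R : ℝ} (hR : 0 < R) (hRρ : R < ρ) {δ : ℝ}
    (hδ : 0 < δ) : ∃ q : ℝ, 0 < q ∧ q < 1 ∧
      ∀ θ : ℝ, δ ≤ |θ| → |θ| ≤ Real.pi → ‖G (R * exp (I * θ))‖ ≤ q * (G R).re := by
  have hpos : 0 < (G R).re := (Complex.pos_iff.1 (hG.apply_pos hR.le hRρ)).1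
  set K : Set ℝ := {θ : ℝ | δ ≤ |θ| ∧ |θ| ≤ Real.pi} with hK
  have hKc : IsCompact K := by
    refine (isCompact_Icc (a := -Real.pi) (b := Real.pi)).of_isClosed_subset ?_
      fun θ hθ => abs_le.1 hθ.2
    exact (isClosed_le continuous_const continuous_abs).inter
      (isClosed_le continuous_abs continuous_const)
  have hlt (θ : ℝ) (hθ : θ ∈ K) : ‖G (R * exp (I * θ))‖ < (G R).re := by
    refine hG.norm_apply_lt hR hRρ (by rw [mul_comm I, norm_exp_ofReal_mul_I]) fun h => ?_
    obtain ⟨k, hk⟩ := Complex.exp_eq_one_iff.1 h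
    have h1 : (θ : ℂ) = ((k * (2 * Real.pi) : ℝ) : ℂ) := by
      apply mul_left_cancel₀ I_ne_zero
      rw [hk]; push_cast; ring
    have h2 : θ = k * (2 * Real.pi) := by exact_mod_cast h1
    rcases eq_or_ne k 0 with rfl | hk0
    · rw [h2] at hθ
      simp only [hK, Set.mem_ofPred_eq, Int.cast_zero, zero_mul, abs_zero] at hθ
      linarith [hθ.1]
    · have h3 : (1 : ℝ) ≤ |(k : ℝ)| := by exact_mod_cast Int.one_le_abs hk0
      have h4 := hθ.2
      rw [h2, abs_mul, abs_of_pos Real.two_pi_pos] at h4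
      nlinarith [Real.pi_pos]
  rcases K.eq_empty_or_nonempty with hemp | hne
  · refine ⟨1 / 2, by norm_num, by norm_num, fun θ h1 h2 => ?_⟩
    have : θ ∈ K := ⟨h1, h2⟩
    rw [hemp] at this
    exact this.elim
  · obtain ⟨θ₀, hθ₀, hmax⟩ := hKc.exists_isMaxOn hne
      ((hG.continuous_circle hR hRρ).norm.continuousOn)
    have h1 := hlt θ₀ hθ₀
    refine ⟨(‖G (R * exp (I * θ₀))‖ / (G R).re + 1) / 2, by positivity, ?_, fun θ h2 h3 => ?_⟩
    · have := (div_lt_one hpos).2 h1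
      linarith
    · have h4 : ‖G (R * exp (I * θ))‖ ≤ ‖G (R * exp (I * θ₀))‖ := hmax (show θ ∈ K from ⟨h2, h3⟩)
      have h5 : (‖G (R * exp (I * θ₀))‖ / (G R).re + 1) / 2 * (G R).re =
          (‖G (R * exp (I * θ₀))‖ + (G R).re) / 2 := by field_simp
      rw [h5]
      linarith

theorem coeff_eq_integral (hG : Subcritical G ρ) {f : PowerSeries ℂ}
    (hf : f = PowerSeries.X * PowerSeries.subst f (taylorPS G)) {R : ℝ} (hR : 0 < R) (hRρ : R < ρ)
    {n : ℕ} (hn : 1 ≤ n) :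
    (n : ℂ) * PowerSeries.coeff n f = (R : ℂ) ^ (1 - (n : ℤ)) / (2 * Real.pi) *
      ∫ θ in (-Real.pi)..Real.pi, exp (I * θ) * (G (R * exp (I * θ)) * exp (-(I * θ))) ^ n := by
  obtain ⟨n, rfl⟩ : ∃ k, n = k + 1 := ⟨n - 1, by omega⟩
  have h0 : PowerSeries.constantCoeff (taylorPS G) ≠ 0 := by
    rw [constantCoeff_taylorPS]
    exact hG.zero_pos.ne'
  have h1 := lagrange_inversion h0 hf n
  have hGa : AnalyticAt ℂ G 0 := hG.analytic 0 (Metric.mem_ball_self hG.radius_pos)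
  rw [← taylorCoeff_pow_eq_integral hG.analytic hR hRρ n]
  rw [← taylorPS_pow hGa, taylorPS, PowerSeries.coeff_mk] at h1
  rw [← h1]
  push_cast
  ring

/-- The exponent of the circular contour integral has a nondegenerate critical point at `t = 0`, with
second derivative `sigmaSq`, so it becomes an exact square in a suitable coordinate. -/
theorem exists_saddle_coordinate (hG : Subcritical G ρ) {R : ℝ} (hR : 0 < R) (hRρ : R < ρ)
    (hroot : (R : ℂ) * deriv (logG G) R = 1) :
    ∃ U : ℂ → ℂ, AnalyticAt ℂ U 0 ∧ U 0 = 1 ∧ ∀ᶠ t in 𝓝 0,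
      logG G (R * exp t) - logG G R - R * deriv (logG G) R * t =
        sigmaSq (logG G) R / 2 * (t * U t) ^ 2 := by
  have hφ := hG.analyticAt_logG hR.le hRρ
  have hc : AnalyticAt ℂ (fun t : ℂ => (R : ℂ) * exp t) 0 := by fun_prop
  have hφc : AnalyticAt ℂ (fun t : ℂ => logG G (R * exp t)) 0 :=
    AnalyticAt.fun_comp (g := logG G) (f := fun t : ℂ => (R : ℂ) * exp t) (by simpa using hφ) hc
  have hlin : AnalyticAt ℂ (fun t : ℂ => (R : ℂ) * deriv (logG G) R * t) 0 := by fun_prop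
  have hder (t : ℂ) : HasDerivAt (fun t : ℂ => (R : ℂ) * exp t) (R * exp t) t :=
    (hasDerivAt_exp t).const_mul _
  have htend : Tendsto (fun t : ℂ => (R : ℂ) * exp t) (𝓝 0) (𝓝 R) := by
    simpa using hc.continuousAt.tendsto
  have hD1 : deriv (fun t : ℂ => logG G (R * exp t) - logG G R - R * deriv (logG G) R * t) =ᶠ[𝓝 0]
      fun t => deriv (logG G) (R * exp t) * (R * exp t) - R * deriv (logG G) R := by
    filter_upwards [htend.eventually hφ.eventually_analyticAt] with t ht
    have h1 := HasDerivAt.comp t ht.differentiableAt.hasDerivAt (hder t)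
    have h2 := (h1.sub_const (logG G R)).sub
      ((hasDerivAt_id t).const_mul ((R : ℂ) * deriv (logG G) R))
    rw [mul_one] at h2
    exact h2.deriv
  refine exists_quadratic_coordinate ((hφc.fun_sub analyticAt_const).fun_sub hlin) (by simp) ?_ ?_
    (hG.sigmaSq_pos hR hRρ hroot).ne'
  · rw [hD1.self_of_nhds]
    simp [mul_comm]
  · rw [hD1.deriv_eq]
    have h0 : HasDerivAt (deriv (logG G)) (deriv (deriv (logG G)) R) ((R : ℂ) * exp 0) := by
      simpa using hφ.deriv.differentiableAt.hasDerivAt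
    have h1 := HasDerivAt.comp (0 : ℂ) h0 (hder 0)
    have h2 := (h1.mul (hder 0)).sub_const ((R : ℂ) * deriv (logG G) R)
    refine h2.deriv.trans ?_
    simp only [Function.comp, exp_zero, mul_one, sigmaSq]
    ring

theorem gCoeff_eq_coeff (hG : Subcritical G ρ) {R : ℝ} (hR : 0 < R) (hRρ : R < ρ)
    (hroot : (R : ℂ) * deriv (logG G) R = 1) {U : ℂ → ℂ} (hU : AnalyticAt ℂ U 0) (hU0 : U 0 = 1)
    (hφ : ∀ᶠ t in 𝓝 0, logG G (R * exp t) - logG G R - R * deriv (logG G) R * t =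
        sigmaSq (logG G) R / 2 * (t * U t) ^ 2) (m : ℕ) :
    gCoeff (logG G) R m =
      PowerSeries.coeff m (taylorPS exp * taylorPS (fun z => (U z)⁻¹) ^ (m + 1)) := by
  have hs := (hG.sigmaSq_pos hR hRρ hroot).ne'
  refine taylorCoeff_fillZero_cpow (by fun_prop) hU hU0 ?_ m
  filter_upwards [nhdsWithin_le_nhds hφ, self_mem_nhdsWithin,
    nhdsWithin_le_nhds (hU.continuousAt.eventually_ne (by rw [hU0]; exact one_ne_zero))]
    with t h1 h2 h3
  have ht : t ≠ 0 := h2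
  rw [h1]
  field_simp

theorem hCoeff_eq_coeff (hG : Subcritical G ρ) {R : ℝ} (hR : 0 < R) (hRρ : R < ρ)
    (hroot : (R : ℂ) * deriv (logG G) R = 1) {U V : ℂ → ℂ}
    (hφ : ∀ᶠ t in 𝓝 0, logG G (R * exp t) - logG G R - R * deriv (logG G) R * t =
        sigmaSq (logG G) R / 2 * (t * U t) ^ 2)
    (hV : AnalyticAt ℂ V 0) (hV0 : V 0 = 1)
    (hUV : ∀ᶠ v in 𝓝 0, v * V v = log (1 + v) * U (log (1 + v))) (m : ℕ) :
    hCoeff (logG G) R m =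
      PowerSeries.coeff m (taylorPS (fun _ => 1) * taylorPS (fun z => (V z)⁻¹) ^ (m + 1)) := by
  have hs := (hG.sigmaSq_pos hR hRρ hroot).ne'
  have hlog : Tendsto (fun v : ℂ => log (1 + v)) (𝓝 0) (𝓝 0) := by
    have : ContinuousAt (fun v : ℂ => log (1 + v)) 0 :=
      ContinuousAt.clog (by fun_prop) (by simp)
    simpa using this.tendsto
  rw [hCoeff]
  have h := taylorCoeff_fillZero_cpow (E := fun _ => 1) (Q := fun v =>
    (1 / 2 * sigmaSq (logG G) R * v ^ 2) / (logG G (R * (1 + v)) - logG G R -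
      R * deriv (logG G) R * log (1 + v))) analyticAt_const hV hV0 ?_ m
  · simpa only [one_mul] using h
  have hne : ∀ᶠ v : ℂ in 𝓝 0, 1 + v ≠ 0 :=
    ContinuousAt.eventually_ne (by fun_prop) (by simp)
  filter_upwards [nhdsWithin_le_nhds (hlog.eventually hφ), nhdsWithin_le_nhds hUV,
    nhdsWithin_le_nhds hne, self_mem_nhdsWithin,
    nhdsWithin_le_nhds (hV.continuousAt.eventually_ne (by rw [hV0]; exact one_ne_zero))]
    with v h1 h2 h3 h4 h5
  have hv : v ≠ 0 := h4
  rw [exp_log h3, ← h2] at h1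
  rw [h1]
  field_simp

/-- The arc `|θ| ≤ δ` carries the Laplace expansion, and the rest of the circle is exponentially small.
The radius `δ` depends on `M`, through the disc where the remainder of order `2M` is analytic. -/
theorem contour_integral_isBigO (hG : Subcritical G ρ) {R : ℝ} (hR : 0 < R) (hRρ : R < ρ)
    (hroot : (R : ℂ) * deriv (logG G) R = 1) {s : ℝ} (hs : 0 < s)
    (hsσ : (s : ℂ) = sigmaSq (logG G) R) {U : ℂ → ℂ} (hU : AnalyticAt ℂ U 0) (hU0 : U 0 = 1)
    (hφ : ∀ᶠ t in 𝓝 0, logG G (R * exp t) - logG G R - R * deriv (logG G) R * t =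
        sigmaSq (logG G) R / 2 * (t * U t) ^ 2) (M : ℕ) :
    (fun n : ℕ => (∫ θ in (-Real.pi)..Real.pi,
        exp (I * θ) * (G (R * exp (I * θ)) * exp (-(I * θ)) / G R) ^ n) -
      ((√(2 * Real.pi / (n * s)) : ℝ) : ℂ) * ∑ m ∈ Finset.range M,
        PowerSeries.coeff (2 * m) (taylorPS exp * taylorPS (fun z => (U z)⁻¹) ^ (2 * m + 1)) *
        ((-1) ^ m * ((2 * m)! : ℂ) / (2 ^ m * (m ! : ℂ))) * (((s : ℂ) * n) ^ m)⁻¹)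
      =O[atTop] fun n : ℕ => (√n)⁻¹ * ((n : ℝ) ^ M)⁻¹ := by
  obtain ⟨r, hr, hre⟩ := exists_expansion_in_coordinate (F := exp) (by fun_prop) hU hU0 (2 * M)
  have hc : ContinuousAt (fun t : ℂ => (R : ℂ) * exp t) 0 := by fun_prop
  have htend : Tendsto (fun t : ℂ => (R : ℂ) * exp t) (𝓝 0) (𝓝 R) := by simpa using hc.tendsto
  have hclose : ∀ᶠ z in 𝓝 (0 : ℂ), ‖U z - 1‖ ≤ 1 / 8 := by
    have : ContinuousAt (fun z => ‖U z - 1‖) 0 := (hU.continuousAt.sub continuousAt_const).norm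
    have h0 : ‖U 0 - 1‖ < 1 / 8 := by simp [hU0]
    exact (this.eventually (gt_mem_nhds h0)).mono fun _ h => le_of_lt h
  have hne : ∀ᶠ t in 𝓝 (0 : ℂ), G (R * exp t) ≠ 0 :=
    htend.eventually ((hG.eventually_hasDerivAt_logG hR.le hRρ).mono fun _ h => h.1)
  have hall := hre.and (hφ.and (hclose.and (hne.and (hU.eventually_analyticAt.and
    hr.eventually_analyticAt))))
  obtain ⟨ε, hε, hball⟩ := (Metric.nhds_basis_closedBall.eventually_iff).1 hall
  -- the bound `3 < π` keeps the arc inside the circle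
  set δ := min ε 3
  have hδ : 0 < δ := lt_min hε (by norm_num)
  have hδπ : δ < Real.pi := (min_le_right _ _).trans_lt Real.pi_gt_three
  have hball' (z : ℂ) (hz : z ∈ Metric.closedBall (0 : ℂ) δ) :=
    hball (Metric.closedBall_subset_closedBall (min_le_left _ _) hz)
  have hcoord : IsCoordinate U δ :=
    ⟨hδ, fun z hz => (hball' z hz).2.2.2.2.1, fun z hz => (hball' z hz).2.2.1⟩
  have hlocal := hcoord.integral_isBigO hs (F := exp) (r := r)
    (fun z hz => (hball' z hz).2.2.2.2.2) M
    (fun k => PowerSeries.coeff k (taylorPS exp * taylorPS (fun z => (U z)⁻¹) ^ (k + 1)))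
    (fun z hz => (hball' z hz).1)
  have hGR : G R ≠ 0 := (hG.apply_pos hR.le hRρ).ne'
  have hGRre : G R = ((G R).re : ℂ) :=
    Complex.eq_re_of_ofReal_le (r := 0) (by simpa using (hG.apply_pos hR.le hRρ).le)
  have hGRpos : 0 < (G R).re := (Complex.pos_iff.1 (hG.apply_pos hR.le hRρ)).1
  set T : ℕ → ℝ → ℂ := fun n θ =>
    exp (I * θ) * (G (R * exp (I * θ)) * exp (-(I * θ)) / G R) ^ n with hT
  have hTc (n : ℕ) : Continuous (T n) := by
    have := hG.continuous_circle hR hRρ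
    have h1 : Continuous fun θ : ℝ => exp (I * θ) := by fun_prop
    have h2 : Continuous fun θ : ℝ => exp (-(I * θ)) := by fun_prop
    exact h1.mul (((this.mul h2).div_const _).pow n)
  have hnear (n : ℕ) : (∫ θ in (-δ)..δ, T n θ) =
      ∫ θ in (-δ)..δ, exp (I * θ) * exp (n * s / 2 * (I * θ * U (I * θ)) ^ 2) := by
    refine intervalIntegral.integral_congr fun θ hθ => ?_
    rw [Set.uIcc_of_le (by linarith)] at hθ
    have hz := hball' _ (I_mul_mem_closedBall (abs_le.2 hθ))
    have h1 := hz.2.1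
    rw [hroot, one_mul, ← hsσ] at h1
    -- at the saddle point `R φ'(R) = 1`, so the factor `exp (-(I * θ))` is the linear term
    have h2 : G (R * exp (I * θ)) * exp (-(I * θ)) / G R =
        exp (s / 2 * (I * θ * U (I * θ)) ^ 2) := by
      rw [← h1, exp_sub, exp_sub, logG, logG, exp_log hz.2.2.2.1, exp_log hGR, exp_neg]
      ring
    rw [hT]
    simp only
    rw [h2, ← exp_nat_mul]
    congr 2
    ring
  obtain ⟨q, hq0, hq1, hq⟩ := hG.exists_ratio_le_of_away hR hRρ hδ
  have hTq (n : ℕ) (θ : ℝ) (h1 : δ ≤ |θ|) (h2 : |θ| ≤ Real.pi) : ‖T n θ‖ ≤ q ^ n := by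
    have e1 : ‖exp (I * θ)‖ = 1 := by rw [mul_comm I, norm_exp_ofReal_mul_I]
    rw [hT]
    simp only [exp_neg, norm_mul, norm_pow, norm_div, norm_inv, e1, one_mul, inv_one, mul_one]
    refine pow_le_pow_left₀ (by positivity) ?_ n
    rw [hGRre, norm_real, Real.norm_of_nonneg hGRpos.le, div_le_iff₀ hGRpos]
    exact hq θ h1 h2
  have hfar : (fun n : ℕ => (∫ θ in (-Real.pi)..(-δ), T n θ) + ∫ θ in δ..Real.pi, T n θ)
      =O[atTop] fun n : ℕ => Real.exp (-(-Real.log q * n)) := by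
    refine IsBigO.of_bound (2 * (Real.pi - δ)) (Eventually.of_forall fun n => ?_)
    have e : Real.exp (-(-Real.log q * n)) = q ^ n := by
      rw [neg_mul, neg_neg, mul_comm, Real.exp_nat_mul, Real.exp_log hq0]
    rw [e, Real.norm_of_nonneg (by positivity)]
    have h1 : ‖∫ θ in (-Real.pi)..(-δ), T n θ‖ ≤ q ^ n * |-δ - -Real.pi| := by
      refine intervalIntegral.norm_integral_le_of_norm_le_const fun θ hθ => hTq n θ ?_ ?_
      · rw [Set.uIoc_of_le (by linarith)] at hθ
        rw [abs_of_nonpos (by linarith [hθ.2])]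
        linarith [hθ.2]
      · rw [Set.uIoc_of_le (by linarith)] at hθ
        rw [abs_of_nonpos (by linarith [hθ.2])]
        linarith [hθ.1]
    have h2 : ‖∫ θ in δ..Real.pi, T n θ‖ ≤ q ^ n * |Real.pi - δ| := by
      refine intervalIntegral.norm_integral_le_of_norm_le_const fun θ hθ => hTq n θ ?_ ?_
      · rw [Set.uIoc_of_le (by linarith)] at hθ
        rw [abs_of_nonneg (by linarith [hθ.1])]
        linarith [hθ.1]
      · rw [Set.uIoc_of_le (by linarith)] at hθ
        rw [abs_of_nonneg (by linarith [hθ.1])]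
        linarith [hθ.2]
    rw [abs_of_nonneg (by linarith)] at h1 h2
    refine (norm_add_le _ _).trans ((add_le_add h1 h2).trans_eq (by ring))
  have hfar' := hfar.trans (exp_neg_isBigO (neg_pos.2 (Real.log_neg hq0 hq1)) M)
  refine (hlocal.add hfar').congr_left fun n => ?_
  have hi (a b : ℝ) : IntervalIntegrable (T n) volume a b := (hTc n).intervalIntegrable a b
  have e1 := intervalIntegral.integral_add_adjacent_intervals (hi (-Real.pi) (-δ)) (hi (-δ) δ)
  have e2 := intervalIntegral.integral_add_adjacent_intervals (hi (-Real.pi) δ) (hi δ Real.pi)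
  rw [← hnear n, ← e2, ← e1]
  ring

theorem hasLagExpansion (hG : Subcritical G ρ) {f : PowerSeries ℂ}
    (hf : f = PowerSeries.X * PowerSeries.subst f (taylorPS G)) {R : ℝ} (hR : 0 < R) (hRρ : R < ρ)
    (hroot : (R : ℂ) * deriv (logG G) R = 1) {σ : ℝ} (hσ : 0 < σ)
    (hσs : (σ : ℂ) ^ 2 = sigmaSq (logG G) R) :
    HasLagExpansion G R σ (gCoeff (logG G) R) (fun n => (n : ℂ) * PowerSeries.coeff n f) := by
  intro M
  obtain ⟨U, hU, hU0, hφ⟩ := hG.exists_saddle_coordinate hR hRρ hroot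
  have hmain := hG.contour_integral_isBigO hR hRρ hroot (s := σ ^ 2) (by positivity)
    (by push_cast; exact hσs) hU hU0 hφ M
  have hGR : G R ≠ 0 := (hG.apply_pos hR.le hRρ).ne'
  have hmul := (isBigO_norm_right.2 (isBigO_refl
    (fun n : ℕ => (R : ℂ) ^ (1 - (n : ℤ)) * G R ^ n / (2 * Real.pi)) atTop)).mul hmain
  have hπ := Real.pi_pos
  refine (hmul.congr' (f₂ := fun n : ℕ => (n : ℂ) * PowerSeries.coeff n f -
    lagPrefactor G R σ n * ∑ m ∈ Finset.range M, gCoeff (logG G) R (2 * m) *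
      ((-1) ^ m * ((2 * m)! : ℂ) / (2 ^ m * (m ! : ℂ))) * (((σ : ℂ) ^ 2 * (n : ℂ)) ^ m)⁻¹)
    ?_ EventuallyEq.rfl).trans ?_
  · filter_upwards [eventually_ge_atTop 1] with n hn
    rw [hG.coeff_eq_integral hf hR hRρ hn, mul_sub]
    congr 1
    · have e (θ : ℝ) : exp (I * θ) * (G (R * exp (I * θ)) * exp (-(I * θ)) / G R) ^ n =
          exp (I * θ) * (G (R * exp (I * θ)) * exp (-(I * θ))) ^ n * (G R ^ n)⁻¹ := by
        rw [div_pow]; ring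
      simp only [e]
      rw [intervalIntegral.integral_mul_const]
      generalize (∫ θ in (-Real.pi)..Real.pi,
        exp (I * θ) * (G (R * exp (I * θ)) * exp (-(I * θ))) ^ n) = J
      field_simp
    · rw [← mul_assoc]
      simp only [hG.gCoeff_eq_coeff hR hRρ hroot hU hU0 hφ]
      push_cast
      congr 1
      have e : √(2 * Real.pi / (n * σ ^ 2)) / (2 * Real.pi) = 1 / (√(2 * Real.pi * n) * σ) := by
        have hn0 : (0 : ℝ) < n := by exact_mod_cast hn
        rw [Real.sqrt_div (by positivity), Real.sqrt_mul hn0.le, Real.sqrt_sq hσ.le,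
          Real.sqrt_mul (by positivity : (0 : ℝ) ≤ 2 * Real.pi)]
        have h1 := Real.sq_sqrt (by positivity : (0 : ℝ) ≤ 2 * Real.pi)
        have h2 : 0 < √(2 * Real.pi) := by positivity
        field_simp
        exact h1
      have e' := congrArg (fun x : ℝ => (x : ℂ)) e
      push_cast at e'
      rw [lagPrefactor]
      push_cast
      linear_combination (R : ℂ) ^ (1 - (n : ℤ)) * G R ^ n * e'
  · refine IsBigO.of_bound (σ / √(2 * Real.pi)) ?_
    filter_upwards [eventually_ge_atTop 1] with n hn
    have hn0 : (0 : ℝ) < n := by exact_mod_cast hn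
    have h1 := Real.mul_self_sqrt (by positivity : (0 : ℝ) ≤ 2 * Real.pi)
    have h2 : 0 < √(2 * Real.pi) := by positivity
    have h3 : 0 < √(n : ℝ) := by positivity
    have hτ : ‖(2 * Real.pi : ℂ)‖ = √(2 * Real.pi) * √(2 * Real.pi) := by
      rw [h1, norm_mul, norm_real, Real.norm_of_nonneg hπ.le, norm_ofNat]
    have hden : ‖((√(2 * Real.pi * n) * σ : ℝ) : ℂ)‖ = √(2 * Real.pi) * √n * σ := by
      rw [norm_real, Real.norm_of_nonneg (by positivity),
        Real.sqrt_mul (by positivity : (0 : ℝ) ≤ 2 * Real.pi)]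
    have hnM : ‖((n : ℂ) ^ M)⁻¹‖ = ((n : ℝ) ^ M)⁻¹ := by
      rw [norm_inv, norm_pow, Complex.norm_natCast]
    rw [lagPrefactor, norm_mul, norm_norm, norm_div, hτ, norm_mul _ ((n : ℂ) ^ M)⁻¹, hnM, norm_div,
      hden, Real.norm_of_nonneg (by positivity : 0 ≤ (√(n : ℝ))⁻¹ * ((n : ℝ) ^ M)⁻¹)]
    refine le_of_eq ?_
    generalize ‖(R : ℂ) ^ (1 - (n : ℤ)) * G R ^ n‖ = A
    field_simp

theorem gCoeff_eq_hCoeff (hG : Subcritical G ρ) {R : ℝ} (hR : 0 < R) (hRρ : R < ρ)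
    (hroot : (R : ℂ) * deriv (logG G) R = 1) (m : ℕ) :
    gCoeff (logG G) R m = hCoeff (logG G) R m := by
  obtain ⟨U, hU, hU0, hφ⟩ := hG.exists_saddle_coordinate hR hRρ hroot
  obtain ⟨V, hV, hV0, h1, h2⟩ := exists_log_coordinate hU hU0
  rw [hG.gCoeff_eq_coeff hR hRρ hroot hU hU0 hφ,
    hG.hCoeff_eq_coeff hR hRρ hroot hφ hV hV0 h1, coeff_exp_coordinate_eq hU hU0 hV hV0 h2]

end Subcritical

end SaddlePoint

theorem theorem2 (G : ℂ → ℂ) (ρ : ℝ) (hG : Subcritical G ρ)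
    (f : PowerSeries ℂ) (hf : f = PowerSeries.X * PowerSeries.subst f (taylorPS G)) :
    (∃! R : ℝ, 0 < R ∧ R < ρ ∧ (R : ℂ) * deriv (logG G) R = 1) ∧
    ∀ R : ℝ, 0 < R → R < ρ → (R : ℂ) * deriv (logG G) R = 1 →
      ∃ σ : ℝ, 0 < σ ∧ (σ : ℂ) ^ 2 = sigmaSq (logG G) R ∧
        HasLagExpansion G R σ (hCoeff (logG G) R) (fun n => (n : ℂ) * PowerSeries.coeff n f) ∧
        HasLagExpansion G R σ (gCoeff (logG G) R) (fun n => (n : ℂ) * PowerSeries.coeff n f) ∧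
        ∀ m : ℕ, gCoeff (logG G) R m = hCoeff (logG G) R m := by
  refine ⟨?_, fun R hR hRρ hroot => ?_⟩
  · obtain ⟨R, ⟨h1, h2, h3⟩, huniq⟩ := hG.root
    refine ⟨R, ⟨h1, h2, (hG.mul_deriv_logG_eq_one_iff h1.le h2).2 h3⟩, fun R' ⟨h4, h5, h6⟩ => ?_⟩
    exact huniq R' ⟨h4, h5, (hG.mul_deriv_logG_eq_one_iff h4.le h5).1 h6⟩
  · have hpos := hG.sigmaSq_pos hR hRρ hroot
    have hre := (Complex.pos_iff.1 hpos).1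
    have hreal : sigmaSq (logG G) R = ((sigmaSq (logG G) R).re : ℂ) :=
      Complex.eq_re_of_ofReal_le (r := 0) (by simpa using hpos.le)
    have hσ : ((√(sigmaSq (logG G) R).re : ℝ) : ℂ) ^ 2 = sigmaSq (logG G) R := by
      rw [← Complex.ofReal_pow, Real.sq_sqrt hre.le, ← hreal]
    have hg := hG.hasLagExpansion hf hR hRρ hroot (Real.sqrt_pos.2 hre) hσ
    have hgh := hG.gCoeff_eq_hCoeff hR hRρ hroot
    exact ⟨_, Real.sqrt_pos.2 hre, hσ, funext hgh ▸ hg, hg, hgh⟩
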